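/- **Setting.** Let $m\ge 2$, $d\ge 0$, $0<\mu$ and $L\ge 2\mu$. Let $f_1,\dots,f_m:\mathbb R^d\to\mathbb R$ be $\mu$-strongly convex and $L$-smooth, i.e. differentiable with $f_i(y)\le f_i(x)+\langle\nabla f_i(x),y-x\rangle+\frac L2\|x-y\|^2$ for all $x,y$. Let $g:\mathbb R^d\to\mathbb R$ be convex (possibly non-smooth), let $F(x)=\frac1m\sum_{i=1}^m f_i(x)+g(x)$, and let $x^*$ be the minimizer of $F$. Let $W\in\mathbb R^{m\times m}$ be a weight matrix of an undirected network on the $m$ agents: $W$ is symmetric, $0\preceq W\preceq I$, $W_{ij}\ne0$ if and only if $i=j$ or $i,j$ are adjacent, $W\mathbf 1=\mathbf 1$, and $\mathrm{null}(I-W)=\mathrm{span}(\mathbf 1)$. Let $\lambda_2(W)$ be its second largest eigenvalue. For $\mathbf x\in\mathbb R^{m\times d}$ let $\mathbf x^{(i)}$ be its $i$-th row, $\overline x=\frac1m\mathbf 1^\top\mathbf x$, $\|\mathbf x\|$ the Frobenius norm, and $\Pi=I-\frac1m\mathbf 1\mathbf 1^\top$. $\mathrm{FastMix}(\mathbf x,K)$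 returns $\mathbf x^K$, where $\mathbf x^0=\mathbf x^1=\mathbf x$, $\mathbf x^{k+1}=(1+\eta_w)W\mathbf x^k-\eta_w\mathbf x^{k-1}$ for $k\ge1$, and $\eta_w=\frac1{1+\sqrt{1-\lambda_2^2(W)}}$. For $\alpha>0$ put $\mathrm{prox}_{\alpha g}(v)=\arg\min_w\{\alpha g(w)+\frac12\|w-v\|^2\}$, applied to each row of a matrix. **Algorithm.** Given $x_1\in\mathbb R^d$, put $\widehat\gamma=\frac1{20\sqrt{(L-\mu)\mu}}$, $\widehat\tau=\mu\widehat\gamma$, let $K$ be any integer with $K\ge\frac{11}{\sqrt{1-\lambda_2(W)}}$ (for instance the least one), and write $\nabla\widehat f(\mathbf x)$ for the $m\times d$ matrix with rows $\nabla f_i(\mathbf x^{(i)})-\mu\mathbf x^{(i)}$. Start from $\mathbf x_1=\mathbf y_1=\mathbf z_1=\mathbf 1x_1$ and $\mathbf s_1=\nabla\widehat f(\mathbf x_1)$, and for $t\ge1$ let $$\mathbf x_{t+1}=\widehat\tau\mathbf z_t+(1-\widehat\tau)\mathbf y_t,\qquad \mathbf s_{t+1}=\mathrm{FastMix}\big(\mathbf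 s_t+\nabla\widehat f(\mathbf x_{t+1})-\nabla\widehat f(\mathbf x_t),K\big),$$ $$\mathbf z_{t+1}=\mathrm{FastMix}\Big(\mathrm{prox}_{\frac{\widehat\gamma}{1+\mu\widehat\gamma}g}\Big(\tfrac1{1+\mu\widehat\gamma}(\mathbf z_t-\widehat\gamma\mathbf s_{t+1})\Big),K\Big),\qquad \mathbf y_{t+1}=\mathrm{FastMix}\big(\widehat\tau\mathbf z_{t+1}+(1-\widehat\tau)\mathbf y_t,K\big).$$ **Theorem.** For every integer $T\ge1$, $$\|\mathbf z_T-\mathbf 1x^*\|^2\le\Big(1-\frac1{40}\sqrt{\frac{\mu}{L-\mu}}\Big)^T\Big(\frac{2m}{\mu}\big(F(\overline y_1)-F(x^*)\big)+\|\mathbf z_1-\mathbf 1x^*\|^2+\frac{6\cdot20^2(L-\mu)}{\mu}\big(\|\Pi\mathbf x_1\|^2+c_1\|\Pi\mathbf y_1\|^2+c_2\|\Pi\mathbf z_1\|^2+c_3\widehat\gamma^2\|\Pi\mathbf s_1\|^2\big)\Big),$$ with $c_1=64$, $c_2=\frac{9\widehat\tau^2}{32}$ and $c_3=\frac{5\widehat\tau^2}{14}$.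 -/

import Mathlib

noncomputable section

/-- The local copies of the `m` agents: an `m × d` real matrix, given by its rows. -/
abbrev Agents (m d : ℕ) : Type := Fin m → EuclideanSpace ℝ (Fin d)

namespace Agents

variable {m d : ℕ}

/-- The matrix `𝟏 v`, all of whose rows are equal to `v`. -/
def const (m : ℕ) (v : EuclideanSpace ℝ (Fin d)) : Agents m d := fun _ => v

/-- The average `(1 / m) 𝟏ᵀ x` of the rows. -/
def avg (x : Agents m d) : EuclideanSpace ℝ (Fin d) := (1 / (m : ℝ)) • ∑ i, x i

/-- The squared Frobenius norm. -/
def normSq (x : Agents m d) : ℝ := ∑ i, ‖x i‖ ^ 2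

/-- The matrix product `A x`. -/
def leftMul (A : Matrix (Fin m) (Fin m) ℝ) (x : Agents m d) : Agents m d :=
  fun i => ∑ j, A i j • x j

end Agents

/-- The projection matrix `Π = I - 𝟏 𝟏ᵀ / m`. -/
def consensusProj (m : ℕ) : Matrix (Fin m) (Fin m) ℝ :=
  1 - (1 / (m : ℝ)) • Matrix.of (fun _ _ => (1 : ℝ))

/-- `f` is differentiable and satisfies the quadratic upper bound with constant `L`. -/
def IsLSmooth {d : ℕ} (L : ℝ) (f : EuclideanSpace ℝ (Fin d) → ℝ) : Prop :=
  Differentiable ℝ f ∧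
    ∀ x y, f y ≤ f x + inner ℝ (gradient f x) (y - x) + L / 2 * ‖x - y‖ ^ 2

/-- `F = (1 / m) ∑ fᵢ + g`. -/
def compositeObj {m d : ℕ} (f : Fin m → EuclideanSpace ℝ (Fin d) → ℝ)
    (g : EuclideanSpace ℝ (Fin d) → ℝ) (x : EuclideanSpace ℝ (Fin d)) : ℝ :=
  (1 / (m : ℝ)) * ∑ i, f i x + g x

/-- Weight matrices of an undirected network `G` of `m` agents: `W` is symmetric with
`0 ⪯ W ⪯ I`, its support is given by the edges of `G` and the diagonal, `W 𝟏 = 𝟏`, and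
`null (I - W) = span 𝟏` (which forces `G` to be connected). -/
structure IsWeightMatrix {m : ℕ} (G : SimpleGraph (Fin m)) (W : Matrix (Fin m) (Fin m) ℝ) :
    Prop where
  posSemidef : W.PosSemidef
  le_one : (1 - W).PosSemidef
  support : ∀ i j, W i j ≠ 0 ↔ G.Adj i j ∨ i = j
  mulVec_one : W.mulVec (fun _ => 1) = fun _ => 1
  null : LinearMap.ker (Matrix.toLin' (1 - W)) = Submodule.span ℝ {fun _ => (1 : ℝ)}

/-- The second largest eigenvalue (with multiplicity) of a real symmetric `m × m` matrix,
`m ≥ 2`; `eigenvalues₀` lists the eigenvalues in decreasing order, starting at index `0`. -/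
def lambda2 {m : ℕ} {W : Matrix (Fin m) (Fin m) ℝ} (hW : W.IsHermitian) (hm : 2 ≤ m) : ℝ :=
  hW.eigenvalues₀ ⟨1, by rw [Fintype.card_fin]; omega⟩

/-- The momentum parameter of `FastMix`, as a function of the second largest eigenvalue. -/
def mixEta (lam : ℝ) : ℝ := 1 / (1 + √(1 - lam ^ 2))

/-- The iterates of `FastMix`: `x⁰ = x¹` is the input and
`xᵏ⁺¹ = (1 + η) W xᵏ - η xᵏ⁻¹` for `k ≥ 1`. -/
def fastMixSeq {m d : ℕ} (W : Matrix (Fin m) (Fin m) ℝ) (η : ℝ) (x : Agents m d) :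
    ℕ → Agents m d
  | 0 => x
  | 1 => x
  | k + 2 => (1 + η) • Agents.leftMul W (fastMixSeq W η x (k + 1)) - η • fastMixSeq W η x k

/-- `FastMix (x, K)`: the iterate `xᴷ`. -/
def fastMix {m d : ℕ} (W : Matrix (Fin m) (Fin m) ℝ) (η : ℝ) (K : ℕ) (x : Agents m d) :
    Agents m d :=
  fastMixSeq W η x K

/-- The proximal operator: `prox_{γ g} (v)` is a minimizer of `w ↦ γ g(w) + ‖w - v‖² / 2`. -/
def prox {d : ℕ} (γ : ℝ) (g : EuclideanSpace ℝ (Fin d) → ℝ) (v : EuclideanSpace ℝ (Fin d)) :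
    EuclideanSpace ℝ (Fin d) :=
  Classical.epsilon fun w => IsMinOn (fun u => γ * g u + 1 / 2 * ‖u - v‖ ^ 2) Set.univ w

/-- The aggregated gradient of `f̂ᵢ = fᵢ - (μ / 2) ‖·‖²`; row `i` is `∇ fᵢ (xᵢ) - μ xᵢ`. -/
def gradHat {m d : ℕ} (μ : ℝ) (f : Fin m → EuclideanSpace ℝ (Fin d) → ℝ) (x : Agents m d) :
    Agents m d :=
  fun i => gradient (f i) (x i) - μ • x i

/-- The variables `(x_t, y_t, z_t, s_t)` of the algorithm. -/
structure OdapgState (m d : ℕ) where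
  x : Agents m d
  y : Agents m d
  z : Agents m d
  s : Agents m d

/-- Initialization: `z₁ = y₁ = x₁ = 𝟏 x₁` and `s₁ = ∇ f̂ (x₁)`. -/
def odapgInit {m d : ℕ} (μ : ℝ) (f : Fin m → EuclideanSpace ℝ (Fin d) → ℝ)
    (x₁ : EuclideanSpace ℝ (Fin d)) : OdapgState m d where
  x := Agents.const m x₁
  y := Agents.const m x₁
  z := Agents.const m x₁
  s := gradHat μ f (Agents.const m x₁)

/-- One round, from index `t` to index `t + 1`; `mix` is the consensus operator. -/
def odapgStep {m d : ℕ} (μ γ τ : ℝ) (f : Fin m → EuclideanSpace ℝ (Fin d) → ℝ)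
    (g : EuclideanSpace ℝ (Fin d) → ℝ) (mix : Agents m d → Agents m d)
    (p : OdapgState m d) : OdapgState m d :=
  let x' : Agents m d := τ • p.z + (1 - τ) • p.y
  let s' : Agents m d := mix (p.s + gradHat μ f x' - gradHat μ f p.x)
  let z' : Agents m d := mix fun i =>
    prox (γ / (1 + μ * γ)) g ((1 / (1 + μ * γ)) • (p.z i - γ • s' i))
  let y' : Agents m d := mix (τ • z' + (1 - τ) • p.y)
  { x := x', y := y', z := z', s := s' }

/-- The state after `n` rounds; the variables with index `t ≥ 1` are those after `t - 1`
rounds. -/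
def odapg {m d : ℕ} (μ γ τ : ℝ) (f : Fin m → EuclideanSpace ℝ (Fin d) → ℝ)
    (g : EuclideanSpace ℝ (Fin d) → ℝ) (mix : Agents m d → Agents m d)
    (x₁ : EuclideanSpace ℝ (Fin d)) : ℕ → OdapgState m d
  | 0 => odapgInit μ f x₁
  | n + 1 => odapgStep μ γ τ f g mix (odapg μ γ τ f g mix x₁ n)

end

/-! Moving `μ / 2 * ‖v‖ ^ 2` from each `f i` to `g` leaves convex `h`-smooth functions `φ i`, with
`h = L - μ`, and a `μ`-strongly convex regularizer. The row averages then almost run an accelerated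
proximal gradient method: mixing preserves averages, so the average of `s` is always the average of
the current gradients (`avg_odapg_s`). What must be controlled is the disagreement between rows.

Mixing. In an eigenbasis of `W`, `FastMix` splits into scalar momentum recursions. Each has a
quadratic energy multiplied by exactly `η` per step, and `K` steps shrink the squared disagreement
by `3 / 2048` (`dis_fastMix_le`).

Optimization. With `B = (2m / μ) (F(ȳ) - F(x*))`, `Z = ∑ ‖zᵢ - x*‖²` and a weighted consensus error
`E`, one round gives `B' + (1 + τ) Z' + E' ≤ (1 - τ) B + Z + (39/40) E` (`odapgStep_lyapunov`). Two
negative terms of the descent estimate absorb the gradient tracking error: the gradient gap `Γ`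
between the rows of the new `x` and the average of `y`, and the squared movement of the averaged
`z`. The latter is why `E` also carries the distance between the averages of `x` and `y`.

Iterating yields the factor `1 - τ / 2` per round. Strong convexity of `F` gives `Z ≤ B` at the
start, which supplies the one extra factor (`lyapunov_iterate`). -/

/-! ### Momentum recursion for a single eigenvalue. -/

/-- The quadratic form in `key` is multiplied by exactly `η` at each step. Completing the square in
`a (k + 1)` leaves the multiple of `‖a k‖ ^ 2` on the left. -/
theorem momentum_energy_bound {E : Type*} [NormedAddCommGroup E] [InnerProductSpace ℝ E]
    {η l : ℝ} {a : ℕ → E} (h01 : a 1 = a 0)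
    (hrec : ∀ k, a (k + 2) = (1 + η) • l • a (k + 1) - η • a k) (k : ℕ) :
    (η - (1 + η) ^ 2 * l ^ 2 / 4) * ‖a k‖ ^ 2 ≤ η ^ k * ((1 + η) * (1 - l)) * ‖a 0‖ ^ 2 := by
  have key : ∀ k, ‖a (k + 1)‖ ^ 2 - (1 + η) * l * inner ℝ (a k) (a (k + 1)) + η * ‖a k‖ ^ 2 =
      η ^ k * ((1 + η) * (1 - l)) * ‖a 0‖ ^ 2 := by
    intro k
    induction k with
    | zero =>
      rw [zero_add, h01, real_inner_self_eq_norm_sq]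
      ring
    | succ k ih =>
      have hs : η ^ (k + 1) * ((1 + η) * (1 - l)) * ‖a 0‖ ^ 2 =
          η * (η ^ k * ((1 + η) * (1 - l)) * ‖a 0‖ ^ 2) := by ring
      rw [hs, ← ih]
      rw [show k + 1 + 1 = k + 2 from rfl, hrec k]
      simp only [← real_inner_self_eq_norm_sq, inner_sub_left, inner_sub_right, inner_smul_left,
        inner_smul_right, RCLike.conj_to_real, real_inner_comm (a k) (a (k + 1))]
      ring
  have hsq : 0 ≤ ‖a (k + 1) - ((1 + η) * l / 2) • a k‖ ^ 2 := by positivity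
  rw [← key k]
  simp only [← real_inner_self_eq_norm_sq, inner_sub_left, inner_sub_right, inner_smul_left,
    inner_smul_right, RCLike.conj_to_real, real_inner_comm (a k) (a (k + 1))] at hsq ⊢
  linarith

theorem mixEta_pos (l : ℝ) : 0 < mixEta l := by
  unfold mixEta
  positivity

/-- Right side minus left side is a concave quadratic in `l`, so the endpoints suffice. At `l = 0`
it is `2η - 1 ≥ 0`; at `l = l₂`, the bound `1 - l₂ ≤ s ^ 2` reduces it to `s ^ 2 * (1 - s) / (4 * (1
+ s)) ≥ 0`. -/
theorem mixEta_discriminant {l l₂ : ℝ} (h0 : 0 ≤ l) (hl : l ≤ l₂) (h1 : l₂ < 1) :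
    (1 + mixEta l₂) * (1 - l) ≤ 3 * (mixEta l₂ - (1 + mixEta l₂) ^ 2 * l ^ 2 / 4) := by
  have hl₂ : 0 ≤ l₂ := h0.trans hl
  set s := √(1 - l₂ ^ 2) with hs
  have hs0 : 0 ≤ s := Real.sqrt_nonneg _
  have hsq : s ^ 2 = 1 - l₂ ^ 2 := Real.sq_sqrt (by nlinarith)
  have hs1 : s ≤ 1 := by nlinarith
  set η := mixEta l₂ with hη
  have hη1 : η * (1 + s) = 1 := by
    rw [hη, mixEta, ← hs]
    field_simp
  have hη0 : 0 < η := mixEta_pos _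
  have hη2 : 1 / 2 ≤ η := by nlinarith
  have hend : (1 + η) * (1 - l₂) ≤ 3 * (η - (1 + η) ^ 2 * l₂ ^ 2 / 4) := by
    have hstep : (1 + η) * s ^ 2 ≤ 3 * (η - (1 + η) ^ 2 * (1 - s ^ 2) / 4) := by
      have : η = 1 / (1 + s) := by field_simp; linarith
      rw [this]
      have hp : 0 < 1 + s := by linarith
      rw [← sub_nonneg]
      have : 3 * (1 / (1 + s) - (1 + 1 / (1 + s)) ^ 2 * (1 - s ^ 2) / 4) -
          (1 + 1 / (1 + s)) * s ^ 2 = s ^ 2 * (1 - s) / (4 * (1 + s)) := by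
        field_simp
        ring
      rw [this]
      have : 0 ≤ 1 - s := by linarith
      positivity
    have hl2 : l₂ ^ 2 ≤ l₂ := by nlinarith
    rw [show l₂ ^ 2 = 1 - s ^ 2 by linarith]
    nlinarith
  rcases hl₂.eq_or_lt with h | h
  · have : l = 0 := by linarith
    subst this
    nlinarith
  · have hchord : l ^ 2 ≤ l * l₂ := by nlinarith
    have h3 : 0 ≤ 3 * (1 + η) ^ 2 / 4 * (l * l₂ - l ^ 2) :=
      mul_nonneg (by positivity) (by linarith)
    have h4 := mul_le_mul_of_nonneg_left hend h0
    have h5 : 0 ≤ (l₂ - l) * (3 * η - (1 + η)) := mul_nonneg (by linarith) (by linarith)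
    have h6 : 0 ≤ l₂ * (3 * η - 3 / 4 * (1 + η) ^ 2 * (l * l₂) - (1 + η) * (1 - l)) := by
      linarith
    have h7 := nonneg_of_mul_nonneg_right h6 h
    linarith

/-- Bernoulli gives `1 / η = 1 + s ≥ 2 ^ s` for `0 ≤ s ≤ 1`, and `s * K ≥ 11` because `s ≥ √(1 -
l)`; finally `2 ^ 11 = 2048`. -/
theorem mixEta_pow_le {l : ℝ} (h0 : 0 ≤ l) (h1 : l < 1) {K : ℕ} (hK : 11 / √(1 - l) ≤ (K : ℝ)) :
    mixEta l ^ K ≤ 1 / 2048 := by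
  have hs' : 0 < √(1 - l) := Real.sqrt_pos.mpr (by linarith)
  have hle : √(1 - l) ≤ √(1 - l ^ 2) := Real.sqrt_le_sqrt (by nlinarith)
  have hs1 : √(1 - l ^ 2) ≤ 1 := Real.sqrt_le_one.mpr (by nlinarith)
  set s := √(1 - l ^ 2) with hs
  have hs0 : 0 < s := hs'.trans_le hle
  have hKs : 11 ≤ s * K := by
    rw [div_le_iff₀ hs'] at hK
    nlinarith [Nat.cast_nonneg (α := ℝ) K]
  have hb : (2 : ℝ) ^ s ≤ 1 + s := by
    have := rpow_one_add_le_one_add_mul_self (s := 1) (by norm_num) hs0.le hs1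
    norm_num at this
    exact this
  have hpow : (2048 : ℝ) ≤ (1 + s) ^ K := by
    calc (2048 : ℝ) = (2 : ℝ) ^ (11 : ℝ) := by norm_num
      _ ≤ (2 : ℝ) ^ (s * K) := Real.rpow_le_rpow_of_exponent_le (by norm_num) hKs
      _ = ((2 : ℝ) ^ s) ^ K := by rw [Real.rpow_mul (by norm_num), Real.rpow_natCast]
      _ ≤ (1 + s) ^ K := by gcongr
  rw [mixEta, ← hs, one_div_pow]
  exact one_div_le_one_div_of_le (by norm_num) hpow

theorem momentum_decay {E : Type*} [NormedAddCommGroup E] [InnerProductSpace ℝ E]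
    {l l₂ : ℝ} (h0 : 0 ≤ l) (hl : l ≤ l₂) (h1 : l₂ < 1) {a : ℕ → E} (h01 : a 1 = a 0)
    (hrec : ∀ k, a (k + 2) = (1 + mixEta l₂) • l • a (k + 1) - mixEta l₂ • a k)
    {K : ℕ} (hK : 11 / √(1 - l₂) ≤ (K : ℝ)) : ‖a K‖ ^ 2 ≤ 3 / 2048 * ‖a 0‖ ^ 2 := by
  have hE := momentum_energy_bound h01 hrec K
  have hD := mixEta_discriminant h0 hl h1
  have hP := mixEta_pow_le (h0.trans hl) h1 hK
  set η := mixEta l₂ with hη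
  have hη0 : 0 < η := mixEta_pos _
  have hc : 0 < (1 + η) * (1 - l) := mul_pos (by linarith) (by linarith)
  have h2 : (1 + η) * (1 - l) * ‖a K‖ ^ 2 ≤
      (1 + η) * (1 - l) * (3 / 2048 * ‖a 0‖ ^ 2) := by
    calc (1 + η) * (1 - l) * ‖a K‖ ^ 2
        ≤ 3 * (η - (1 + η) ^ 2 * l ^ 2 / 4) * ‖a K‖ ^ 2 := by gcongr
      _ ≤ 3 * (η ^ K * ((1 + η) * (1 - l)) * ‖a 0‖ ^ 2) := by linarith
      _ ≤ 3 * (1 / 2048 * ((1 + η) * (1 - l)) * ‖a 0‖ ^ 2) := by gcongr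
      _ = _ := by ring
  exact le_of_mul_le_mul_left h2 hc

/-! ### Deviations and eigencomponents. -/

namespace Agents

variable {m d : ℕ}

/-- The deviation of the rows from their average. -/
noncomputable def dev (x : Agents m d) : Agents m d := fun i => x i - avg x

/-- The consensus error: the squared Frobenius norm of the deviation from the average. -/
noncomputable def dis (x : Agents m d) : ℝ := normSq (dev x)

/-- The linear combination `uᵀ x` of the rows. -/
noncomputable def coef (u : Fin m → ℝ) (x : Agents m d) : EuclideanSpace ℝ (Fin d) := ∑ i, u i • x i

theorem leftMul_consensusProj (x : Agents m d) : leftMul (consensusProj m) x = dev x := by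
  funext i
  simp only [leftMul, consensusProj, dev, avg, Matrix.sub_apply, Matrix.smul_apply,
    Matrix.of_apply, Matrix.one_apply, sub_smul, Finset.sum_sub_distrib, ite_smul, one_smul,
    zero_smul, Finset.sum_ite_eq, Finset.mem_univ, if_true, Finset.smul_sum, smul_eq_mul, mul_one]

theorem coef_sub (u : Fin m → ℝ) (x y : Agents m d) : coef u (x - y) = coef u x - coef u y := by
  simp [coef, smul_sub, Finset.sum_sub_distrib]

theorem coef_smul (u : Fin m → ℝ) (c : ℝ) (x : Agents m d) : coef u (c • x) = c • coef u x := by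
  simp [coef, Finset.smul_sum, smul_comm c]

theorem coef_leftMul {W : Matrix (Fin m) (Fin m) ℝ} (hW : W.IsHermitian) {u : Fin m → ℝ} {l : ℝ}
    (hu : W.mulVec u = l • u) (x : Agents m d) : coef u (leftMul W x) = l • coef u x := by
  simp only [coef, leftMul, Finset.smul_sum]
  rw [Finset.sum_comm]
  refine Finset.sum_congr rfl fun j _ => ?_
  have huj : ∑ i, W j i * u i = l * u j := congrFun hu j
  rw [smul_smul, ← huj, Finset.sum_smul]
  refine Finset.sum_congr rfl fun i _ => ?_
  rw [smul_smul, mul_comm, ← hW.apply j i, star_trivial]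

theorem avg_eq_coef (x : Agents m d) : avg x = (1 / (m : ℝ)) • coef (fun _ => 1) x := by
  simp [avg, coef]

theorem sum_dev (hm : 0 < m) (x : Agents m d) : ∑ i, dev x i = 0 := by
  have : (m : ℝ) ≠ 0 := by positivity
  simp only [dev, avg, Finset.sum_sub_distrib, Finset.sum_const, Finset.card_univ,
    Fintype.card_fin, ← Nat.cast_smul_eq_nsmul ℝ, smul_smul]
  rw [mul_one_div_cancel this, one_smul, sub_self]

/-- Parseval in each of the `d` columns, summed. -/
theorem sum_norm_coef_sq (b : OrthonormalBasis (Fin m) ℝ (EuclideanSpace ℝ (Fin m)))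
    (x : Agents m d) : ∑ j, ‖coef (b j) x‖ ^ 2 = normSq x := by
  simp only [normSq, EuclideanSpace.real_norm_sq_eq]
  rw [Finset.sum_comm]
  conv_rhs => rw [Finset.sum_comm]
  refine Finset.sum_congr rfl fun c _ => ?_
  have := b.sum_sq_norm_inner_right (WithLp.toLp 2 fun i => x i c)
  rw [EuclideanSpace.real_norm_sq_eq] at this
  rw [← this]
  refine Finset.sum_congr rfl fun j _ => ?_
  rw [Real.norm_eq_abs, sq_abs]
  congr 1
  simp [coef, PiLp.inner_apply, mul_comm]

end Agents

open Agents

theorem coef_fastMixSeq_eq {m d : ℕ} {W : Matrix (Fin m) (Fin m) ℝ} (hW : W.IsHermitian)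
    {u : Fin m → ℝ} {l : ℝ} (hu : W.mulVec u = l • u) (η : ℝ) (x : Agents m d) (k : ℕ) :
    coef u (fastMixSeq W η x (k + 2)) =
      (1 + η) • l • coef u (fastMixSeq W η x (k + 1)) - η • coef u (fastMixSeq W η x k) := by
  rw [fastMixSeq, coef_sub, coef_smul, coef_smul, coef_leftMul hW hu]

theorem avg_fastMix {m d : ℕ} {W : Matrix (Fin m) (Fin m) ℝ} (hW : W.IsHermitian)
    (h1 : W.mulVec (fun _ => 1) = fun _ => 1) (η : ℝ) (x : Agents m d) (K : ℕ) :
    avg (fastMix W η K x) = avg x := by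
  have key : ∀ k, coef (fun _ => 1) (fastMixSeq W η x k) = coef (fun _ => 1) x ∧
      coef (fun _ => 1) (fastMixSeq W η x (k + 1)) = coef (fun _ => 1) x := by
    intro k
    induction k with
    | zero => exact ⟨rfl, rfl⟩
    | succ k ih =>
      refine ⟨ih.2, ?_⟩
      rw [show k + 1 + 1 = k + 2 from rfl,
        coef_fastMixSeq_eq (l := 1) hW (by rw [h1, one_smul]), ih.1, ih.2]
      module
  rw [avg_eq_coef, avg_eq_coef, fastMix, (key K).1]

/-! ### Spectral gap and contraction of `FastMix`. -/

namespace IsWeightMatrix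

variable {m d : ℕ} {G : SimpleGraph (Fin m)} {W : Matrix (Fin m) (Fin m) ℝ}

theorem isHermitian (hW : IsWeightMatrix G W) : W.IsHermitian := hW.posSemidef.isHermitian

theorem eigenvalues_le_one (hW : IsWeightMatrix G W) (j : Fin m) :
    hW.isHermitian.eigenvalues j ≤ 1 := by
  have h := hW.le_one.dotProduct_mulVec_nonneg (hW.isHermitian.eigenvectorBasis j)
  rw [Matrix.sub_mulVec, Matrix.one_mulVec, hW.isHermitian.mulVec_eigenvectorBasis,
    dotProduct_sub, dotProduct_smul, star_trivial] at h
  have h2 : (hW.isHermitian.eigenvectorBasis j : Fin m → ℝ) ⬝ᵥ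
      (hW.isHermitian.eigenvectorBasis j : Fin m → ℝ) = 1 := by
    have := hW.isHermitian.eigenvectorBasis.orthonormal.1 j
    have h3 := EuclideanSpace.real_norm_sq_eq (hW.isHermitian.eigenvectorBasis j)
    rw [this] at h3
    simp only [dotProduct, ← sq]
    linarith
  rw [h2, smul_eq_mul] at h
  linarith

theorem eigenvector_eq_const (hW : IsWeightMatrix G W) {j : Fin m}
    (hj : hW.isHermitian.eigenvalues j = 1) :
    ∃ c : ℝ, ∀ i, hW.isHermitian.eigenvectorBasis j i = c := by
  have hmem : (hW.isHermitian.eigenvectorBasis j : Fin m → ℝ) ∈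
      LinearMap.ker (Matrix.toLin' (1 - W)) := by
    rw [LinearMap.mem_ker, Matrix.toLin'_apply, Matrix.sub_mulVec, Matrix.one_mulVec,
      hW.isHermitian.mulVec_eigenvectorBasis, hj, one_smul, sub_self]
  rw [hW.null, Submodule.mem_span_singleton] at hmem
  obtain ⟨c, hc⟩ := hmem
  exact ⟨c, fun i => by rw [← hc]; simp⟩

/-- The eigenvector that is listed first is constant; all other eigenvalues are at most
`λ₂ < 1`. -/
theorem exists_spectral_gap (hW : IsWeightMatrix G W) (hm : 2 ≤ m) :
    lambda2 hW.posSemidef.isHermitian hm < 1 ∧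
    ∃ j₀ : Fin m, (∃ c : ℝ, c ≠ 0 ∧ ∀ i, hW.isHermitian.eigenvectorBasis j₀ i = c) ∧
      ∀ j, j ≠ j₀ → hW.isHermitian.eigenvalues j ≤ lambda2 hW.posSemidef.isHermitian hm := by
  set H := hW.isHermitian with hH
  set e : Fin (Fintype.card (Fin m)) ≃ Fin m := Fintype.equivOfCardEq (Fintype.card_fin _) with he
  have hcard : Fintype.card (Fin m) = m := Fintype.card_fin m
  set k₀ : Fin (Fintype.card (Fin m)) := ⟨0, by omega⟩ with hk₀
  set k₁ : Fin (Fintype.card (Fin m)) := ⟨1, by omega⟩ with hk₁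
  have heig : ∀ k, H.eigenvalues (e k) = H.eigenvalues₀ k := fun k => by
    simp [Matrix.IsHermitian.eigenvalues, he]
  have hex : ∃ j, H.eigenvalues j = 1 := by
    -- Otherwise the all-ones vector is orthogonal to the whole eigenbasis, against Parseval. The
    -- orthogonality comes from `coef_leftMul` on the one-column matrix of ones, which `W` fixes.
    by_contra! hne
    have h0 : ∀ j, inner ℝ (H.eigenvectorBasis j) (WithLp.toLp 2 fun _ : Fin m => (1 : ℝ)) = 0 := by
      intro j
      have hc := Agents.coef_leftMul (d := 1) H (H.mulVec_eigenvectorBasis j)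
        (fun _ => EuclideanSpace.single 0 1)
      have hfix : Agents.leftMul W (fun _ => EuclideanSpace.single (0 : Fin 1) (1 : ℝ)) =
          fun _ => EuclideanSpace.single (0 : Fin 1) (1 : ℝ) := by
        funext i
        rw [Agents.leftMul, ← Finset.sum_smul]
        have := congrFun hW.mulVec_one i
        simp only [Matrix.mulVec, dotProduct, mul_one] at this
        rw [this, one_smul]
      rw [hfix] at hc
      have hc0 := congrArg (fun v : EuclideanSpace ℝ (Fin 1) => v 0) hc
      simp [Agents.coef] at hc0
      have hi : inner ℝ (H.eigenvectorBasis j) (WithLp.toLp 2 fun _ : Fin m => (1 : ℝ)) =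
          ∑ i, H.eigenvectorBasis j i := by
        simp [PiLp.inner_apply]
      rw [hi]
      have : (H.eigenvalues j - 1) * ∑ i, H.eigenvectorBasis j i = 0 := by linarith
      exact (mul_eq_zero.mp this).resolve_left (sub_ne_zero.mpr (hne j))
    have h1 := H.eigenvectorBasis.sum_sq_norm_inner_right (WithLp.toLp 2 fun _ : Fin m => (1 : ℝ))
    simp only [h0, EuclideanSpace.real_norm_sq_eq] at h1
    have h2 : (2 : ℝ) ≤ m := by exact_mod_cast hm
    simp at h1
    linarith
  have h0 : H.eigenvalues (e k₀) = 1 := by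
    obtain ⟨j, hj⟩ := hex
    refine le_antisymm (hW.eigenvalues_le_one _) ?_
    rw [← hj, ← e.apply_symm_apply j, heig, heig]
    exact H.eigenvalues₀_antitone (Fin.mk_le_of_le_val (Nat.zero_le _))
  obtain ⟨c, hc⟩ := hW.eigenvector_eq_const h0
  have hc0 : c ≠ 0 := by
    rintro rfl
    have h1 := H.eigenvectorBasis.orthonormal.1 (e k₀)
    have h2 : H.eigenvectorBasis (e k₀) = 0 := by
      ext i
      simpa using hc i
    rw [h2, norm_zero] at h1
    exact zero_ne_one h1
  refine ⟨?_, e k₀, ⟨c, hc0, hc⟩, ?_⟩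
  · refine lt_of_le_of_ne ?_ ?_
    · have := hW.eigenvalues_le_one (e k₁)
      rwa [heig] at this
    -- If `λ₂ = 1`, two distinct basis vectors are nonzero constants and cannot be orthogonal.
    · intro h
      have h1 : H.eigenvalues (e k₁) = 1 := by rw [heig]; exact h
      obtain ⟨c', hc'⟩ := hW.eigenvector_eq_const h1
      have hne : e k₀ ≠ e k₁ := by
        rw [Ne, e.apply_eq_iff_eq, hk₀, hk₁, Fin.mk.injEq]
        omega
      have ho := H.eigenvectorBasis.orthonormal.2 hne
      simp only [PiLp.inner_apply, hc, hc'] at ho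
      have hc'0 : c' ≠ 0 := by
        rintro rfl
        have h1 := H.eigenvectorBasis.orthonormal.1 (e k₁)
        have h2 : H.eigenvectorBasis (e k₁) = 0 := by
          ext i
          simpa using hc' i
        rw [h2, norm_zero] at h1
        exact zero_ne_one h1
      simp only [RCLike.inner_apply, RCLike.conj_to_real, Finset.sum_const, Finset.card_univ,
        Fintype.card_fin, nsmul_eq_mul, mul_eq_zero, hc0, hc'0, or_false, Nat.cast_eq_zero] at ho
      omega
  · intro j hj
    rw [← e.apply_symm_apply j, heig]
    refine H.eigenvalues₀_antitone (Fin.mk_le_of_le_val (Nat.one_le_iff_ne_zero.mpr fun h => hj ?_))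
    have h0 : e.symm j = k₀ := Fin.ext h
    rw [← h0, e.apply_symm_apply]

/-- Passing to deviations kills the constant eigencomponent and leaves the others unchanged; each of
those obeys the momentum recursion with an eigenvalue in `[0, λ₂]`. -/
theorem dis_fastMix_le (hW : IsWeightMatrix G W) (hm : 2 ≤ m) {lam : ℝ}
    (hlam : lam = lambda2 hW.posSemidef.isHermitian hm) {K : ℕ}
    (hK : 11 / √(1 - lam) ≤ (K : ℝ)) (x : Agents m d) :
    dis (fastMix W (mixEta lam) K x) ≤ 3 / 2048 * dis x := by
  obtain ⟨h1, j₀, ⟨c, hc0, hc⟩, hgap⟩ := hW.exists_spectral_gap hm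
  rw [← hlam] at h1 hgap
  set H := hW.isHermitian with hH
  set b := H.eigenvectorBasis with hb
  have hzero : ∀ y : Agents m d, coef (b j₀) (dev y) = 0 := fun y => by
    simp only [coef, hc, ← Finset.smul_sum, sum_dev (by omega : 0 < m), smul_zero]
  have hdev : ∀ j, j ≠ j₀ → ∀ y : Agents m d, coef (b j) (dev y) = coef (b j) y := by
    intro j hj y
    have ho := b.orthonormal.2 hj
    simp only [PiLp.inner_apply, hc] at ho
    have hs : ∑ i, b j i = 0 := by
      simp only [RCLike.inner_apply, RCLike.conj_to_real, ← Finset.mul_sum] at ho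
      exact (mul_eq_zero.mp ho).resolve_left hc0
    simp only [coef, dev, smul_sub, Finset.sum_sub_distrib, ← Finset.sum_smul, hs, zero_smul,
      sub_zero]
  rw [dis, dis, ← sum_norm_coef_sq b, ← sum_norm_coef_sq b, Finset.mul_sum]
  refine Finset.sum_le_sum fun j _ => ?_
  by_cases hj : j = j₀
  · rw [hj, hzero, hzero]
    simp
  · rw [hdev j hj, hdev j hj]
    exact momentum_decay (a := fun k => coef (b j) (fastMixSeq W (mixEta lam) x k))
      (hW.posSemidef.eigenvalues_nonneg j) (hgap j hj) h1 rfl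
      (coef_fastMixSeq_eq H (H.mulVec_eigenvectorBasis j) _ x) hK

end IsWeightMatrix

/-! ### Strong convexity, smoothness and proximal steps. -/

section ConvexAnalysis

open Filter Topology

variable {E : Type*} [NormedAddCommGroup E] [InnerProductSpace ℝ E]

theorem StrongConvexOn.add_inner_gradient_le [CompleteSpace E] {f : E → ℝ} {μ : ℝ}
    (hf : StrongConvexOn Set.univ μ f) {x : E} (hd : DifferentiableAt ℝ f x) (u : E) :
    f x + inner ℝ (gradient f x) (u - x) + μ / 2 * ‖u - x‖ ^ 2 ≤ f u := by
  have hline : HasDerivAt (fun t : ℝ => x + t • (u - x)) (u - x) 0 := by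
    simpa using ((hasDerivAt_id (0 : ℝ)).smul_const (u - x)).const_add x
  have hder : HasDerivAt (fun t : ℝ => f (x + t • (u - x))) (inner ℝ (gradient f x) (u - x)) 0 := by
    have hg : HasFDerivAt f (InnerProductSpace.toDual ℝ E (gradient f x)) (x + (0 : ℝ) • (u - x)) := by
      rw [zero_smul, add_zero]
      exact hd.hasGradientAt.hasFDerivAt
    exact hg.comp_hasDerivAt (0 : ℝ) hline
  have hl := hder.tendsto_slope_zero_right
  have hr : Tendsto (fun t : ℝ => f u - f x - (1 - t) * (μ / 2 * ‖u - x‖ ^ 2)) (𝓝[>] 0)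
      (𝓝 (f u - f x - (1 - 0) * (μ / 2 * ‖u - x‖ ^ 2))) :=
    (Continuous.tendsto (by fun_prop) 0).mono_left nhdsWithin_le_nhds
  have hle := le_of_tendsto_of_tendsto hl hr (by
    filter_upwards [Ioo_mem_nhdsGT (zero_lt_one' ℝ)] with t ht
    have h := hf.2 (Set.mem_univ x) (Set.mem_univ u) (sub_nonneg.mpr ht.2.le) ht.1.le (by ring)
    have hpt : (1 - t) • x + t • u = x + t • (u - x) := by module
    rw [hpt, norm_sub_rev x u] at h
    simp only [zero_add, zero_smul, add_zero, smul_eq_mul] at h ⊢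
    rw [inv_mul_le_iff₀ ht.1]
    linarith)
  linarith

/-- Compare `f w` with the value at `(1 - t) w + t u`, divide by `t` and let `t → 0⁺`; the full
constant `k / 2` survives. -/
theorem StrongConvexOn.le_of_isMinOn {f : E → ℝ} {k : ℝ} (hf : StrongConvexOn Set.univ k f)
    {w : E} (hw : IsMinOn f Set.univ w) (u : E) : f w + k / 2 * ‖u - w‖ ^ 2 ≤ f u := by
  have hr : Tendsto (fun t : ℝ => f u - f w - (1 - t) * (k / 2 * ‖u - w‖ ^ 2)) (𝓝[>] 0)
      (𝓝 (f u - f w - (1 - 0) * (k / 2 * ‖u - w‖ ^ 2))) :=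
    (Continuous.tendsto (by fun_prop) 0).mono_left nhdsWithin_le_nhds
  have hle := ge_of_tendsto hr (b := 0) (by
    filter_upwards [Ioo_mem_nhdsGT (zero_lt_one' ℝ)] with t ht
    have h := hf.2 (Set.mem_univ w) (Set.mem_univ u) (sub_nonneg.mpr ht.2.le) ht.1.le (by ring)
    have hmin : f w ≤ f ((1 - t) • w + t • u) := hw (Set.mem_univ _)
    rw [norm_sub_rev w u] at h
    simp only [smul_eq_mul] at h
    refine nonneg_of_mul_nonneg_right ?_ ht.1
    linarith)
  linarith

section Smooth

variable {φ : E → ℝ} {D : E → E} {h : ℝ}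

/-- The lower bound from `x` and the upper bound from `u` are compared at the gradient step `u - e /
h`, where their difference is smallest. -/
theorem bregman_ge_norm_sq_sub (hh : 0 < h)
    (lower : ∀ x u, φ x + inner ℝ (D x) (u - x) ≤ φ u)
    (upper : ∀ x u, φ u ≤ φ x + inner ℝ (D x) (u - x) + h / 2 * ‖u - x‖ ^ 2) (x u : E) :
    φ x + inner ℝ (D x) (u - x) + 1 / (2 * h) * ‖D u - D x‖ ^ 2 ≤ φ u := by
  set e := D u - D x with he
  have h1 := lower x (u - (1 / h) • e)
  have h2 := upper u (u - (1 / h) • e)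
  have h3 : u - (1 / h) • e - u = -((1 / h) • e) := by abel
  have h4 : u - (1 / h) • e - x = (u - x) - (1 / h) • e := by abel
  have h5 : inner ℝ (D u) e - inner ℝ (D x) e = ‖e‖ ^ 2 := by
    rw [← inner_sub_left, ← he, real_inner_self_eq_norm_sq]
  rw [h3, inner_neg_right, inner_smul_right, norm_neg, norm_smul, mul_pow, Real.norm_eq_abs,
    sq_abs] at h2
  rw [h4, inner_sub_right, inner_smul_right] at h1
  have h6 : h / 2 * ((1 / h) ^ 2 * ‖e‖ ^ 2) = 1 / h * ‖e‖ ^ 2 - 1 / (2 * h) * ‖e‖ ^ 2 := by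
    field_simp
    ring
  have h7 : 1 / h * ‖e‖ ^ 2 = 1 / h * inner ℝ (D u) e - 1 / h * inner ℝ (D x) e := by
    rw [← h5]; ring
  linarith

/-- Adding the two Bregman bounds gives cocoercivity; Cauchy–Schwarz turns it into a Lipschitz
bound. -/
theorem norm_sq_sub_le_of_smooth (hh : 0 < h)
    (lower : ∀ x u, φ x + inner ℝ (D x) (u - x) ≤ φ u)
    (upper : ∀ x u, φ u ≤ φ x + inner ℝ (D x) (u - x) + h / 2 * ‖u - x‖ ^ 2) (x u : E) :
    ‖D u - D x‖ ^ 2 ≤ h ^ 2 * ‖u - x‖ ^ 2 := by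
  have h1 := bregman_ge_norm_sq_sub hh lower upper x u
  have h2 := bregman_ge_norm_sq_sub hh lower upper u x
  have h3 : inner ℝ (D u) (x - u) = - inner ℝ (D u) (u - x) := by
    rw [← inner_neg_right, neg_sub]
  have h4 : inner ℝ (D u) (u - x) - inner ℝ (D x) (u - x) ≤ ‖D u - D x‖ * ‖u - x‖ := by
    rw [← inner_sub_left]
    exact real_inner_le_norm _ _
  rw [h3, norm_sub_rev (D x)] at h2
  have h5 : 1 / h * ‖D u - D x‖ ^ 2 ≤ ‖D u - D x‖ * ‖u - x‖ := by
    have : 1 / h * ‖D u - D x‖ ^ 2 = 2 * (1 / (2 * h) * ‖D u - D x‖ ^ 2) := by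
      field_simp
    linarith
  have h6 : ‖D u - D x‖ ^ 2 ≤ h * (‖D u - D x‖ * ‖u - x‖) := by
    rwa [one_div, inv_mul_le_iff₀ hh] at h5
  nlinarith [sq_nonneg (‖D u - D x‖ - h * ‖u - x‖)]

/-- Comparison of the values of a convex smooth function at `v` and at a convex combination of
`u₁` and `u₂`, through the gradient at a third point `x`. -/
theorem smooth_convex_combination_bound (hh : 0 < h)
    (lower : ∀ x u, φ x + inner ℝ (D x) (u - x) ≤ φ u)
    (upper : ∀ x u, φ u ≤ φ x + inner ℝ (D x) (u - x) + h / 2 * ‖u - x‖ ^ 2)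
    {τ : ℝ} (h0 : 0 ≤ τ) (h1 : τ ≤ 1) (x v u₁ u₂ : E) :
    φ v ≤ τ * φ u₁ + (1 - τ) * φ u₂ + inner ℝ (D x) (v - (τ • u₁ + (1 - τ) • u₂)) +
      h / 2 * ‖v - x‖ ^ 2 - (1 - τ) * (1 / (2 * h) * ‖D x - D u₂‖ ^ 2) := by
  have hv := upper x v
  have h2 := mul_le_mul_of_nonneg_left (lower x u₁) h0
  -- The sharpened lower bound is used only at `u₂`; its gradient gap is the reserve that later pays
  -- for gradient tracking.
  have h3 := mul_le_mul_of_nonneg_left (bregman_ge_norm_sq_sub hh lower upper x u₂)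
    (sub_nonneg.mpr h1)
  rw [norm_sub_rev (D u₂)] at h3
  simp only [inner_sub_right, inner_add_right, inner_smul_right] at hv h2 h3 ⊢
  linarith

end Smooth

theorem strongConvexOn_half_norm_sub_sq (v : E) :
    StrongConvexOn Set.univ 1 fun u => 1 / 2 * ‖u - v‖ ^ 2 := by
  rw [strongConvexOn_iff_convex]
  have : (fun x : E => 1 / 2 * ‖x - v‖ ^ 2 - 1 / 2 * ‖x‖ ^ 2) =
      fun x => -(innerSL ℝ v).toLinearMap x + 1 / 2 * ‖v‖ ^ 2 := by
    funext x
    rw [norm_sub_sq_real]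
    simp only [ContinuousLinearMap.coe_coe, innerSL_apply_apply, real_inner_comm x v]
    ring
  rw [this]
  exact ((-(innerSL ℝ v).toLinearMap).convexOn convex_univ).add_const _

theorem strongConvexOn_prox_objective {g : E → ℝ} (hg : ConvexOn ℝ Set.univ g) {c : ℝ} (hc : 0 ≤ c)
    (v : E) : StrongConvexOn Set.univ 1 fun u => c * g u + 1 / 2 * ‖u - v‖ ^ 2 := by
  have h := (strongConvexOn_half_norm_sub_sq v).add (strongConvexOn_zero.mpr (hg.smul hc))
  have h2 : (fun u => c * g u + 1 / 2 * ‖u - v‖ ^ 2) =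
      (fun u => 1 / 2 * ‖u - v‖ ^ 2) + fun u => c • g u := by
    funext u
    simp only [Pi.add_apply, smul_eq_mul]
    ring
  rw [h2]
  refine h.mono fun r => ?_
  simp

theorem exists_isMinOn_prox_objective [FiniteDimensional ℝ E] {g : E → ℝ}
    (hg : ConvexOn ℝ Set.univ g) {c : ℝ} (hc : 0 ≤ c) (v : E) :
    ∃ w, IsMinOn (fun u => c * g u + 1 / 2 * ‖u - v‖ ^ 2) Set.univ w := by
  set F : E → ℝ := fun u => c * g u + 1 / 2 * ‖u - v‖ ^ 2 with hF
  have hsc := strongConvexOn_prox_objective hg hc v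
  have hgc : Continuous g := continuousOn_univ.mp (hg.continuousOn isOpen_univ)
  have hFc : Continuous F := by fun_prop
  have hcg : Continuous fun u => c * g u := by fun_prop
  obtain ⟨b, hb⟩ := ((isCompact_closedBall v 1).image hcg).bddBelow
  have hb' : ∀ u, ‖u - v‖ ≤ 1 → b ≤ c * g u := fun u hu =>
    hb ⟨u, by rwa [Metric.mem_closedBall, dist_eq_norm], rfl⟩
  have hbv : b ≤ c * g v := hb' v (by simp)
  set A := c * g v - b with hA
  have hA0 : 0 ≤ A := by linarith
  -- Convexity along the ray from `v` gives `c * g u ≥ c * g v - A * r`, and `r ^ 2 / 2` outweighs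
  -- `A * r` once `r ≥ 2 * A`.
  have hfar : ∀ u, 2 * A + 1 < ‖u - v‖ → F v ≤ F u := by
    intro u hu
    have hr : 0 < ‖u - v‖ := by linarith
    set r := ‖u - v‖ with hrdef
    have hcon := hg.2 (Set.mem_univ v) (Set.mem_univ u)
      (sub_nonneg.mpr ((div_le_one hr).mpr (by linarith : 1 ≤ r))) (by positivity : 0 ≤ 1 / r)
      (by ring)
    have hball := hb' ((1 - 1 / r) • v + (1 / r) • u) (by
      rw [show (1 - 1 / r) • v + (1 / r) • u - v = (1 / r) • (u - v) by module, norm_smul,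
        Real.norm_of_nonneg (by positivity), ← hrdef]
      exact (one_div_mul_cancel hr.ne').le)
    have h1 := hball.trans (mul_le_mul_of_nonneg_left hcon hc)
    simp only [smul_eq_mul] at h1
    have h2 : r * b ≤ (r - 1) * (c * g v) + c * g u := by
      have := mul_le_mul_of_nonneg_left h1 hr.le
      have h3 : r * (c * ((1 - 1 / r) * g v + 1 / r * g u)) =
          (r - 1) * (c * g v) + c * g u := by
        field_simp
      linarith
    simp only [hF, sub_self, norm_zero, ← hrdef]
    nlinarith
  obtain ⟨w, hw, hmin⟩ := (isCompact_closedBall v (2 * A + 1)).exists_isMinOn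
    ⟨v, Metric.mem_closedBall_self (by linarith)⟩ hFc.continuousOn
  refine ⟨w, fun u _ => ?_⟩
  by_cases hu : ‖u - v‖ ≤ 2 * A + 1
  · exact hmin (by rwa [Metric.mem_closedBall, dist_eq_norm])
  · exact (hmin (Metric.mem_closedBall_self (by linarith)) : F w ≤ F v).trans
      (hfar u (not_le.mp hu))

end ConvexAnalysis

theorem prox_isMinOn {d : ℕ} {g : EuclideanSpace ℝ (Fin d) → ℝ} (hg : ConvexOn ℝ Set.univ g)
    {c : ℝ} (hc : 0 ≤ c) (v : EuclideanSpace ℝ (Fin d)) :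
    IsMinOn (fun u => c * g u + 1 / 2 * ‖u - v‖ ^ 2) Set.univ (prox c g v) :=
  Classical.epsilon_spec (exists_isMinOn_prox_objective hg hc v)

/-- The three-point inequality for the proximal step, in terms of the regularizer
`g + (μ / 2) ‖·‖²`. -/
theorem prox_three_point {d : ℕ} {g : EuclideanSpace ℝ (Fin d) → ℝ} (hg : ConvexOn ℝ Set.univ g)
    {μ γ : ℝ} (hμ : 0 ≤ μ) (hγ : 0 ≤ γ) (z s u : EuclideanSpace ℝ (Fin d))
    {w : EuclideanSpace ℝ (Fin d)}
    (hw : w = prox (γ / (1 + μ * γ)) g ((1 / (1 + μ * γ)) • (z - γ • s))) :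
    γ * ((g w + μ / 2 * ‖w‖ ^ 2) - (g u + μ / 2 * ‖u‖ ^ 2)) + γ * inner ℝ s (w - u) +
      1 / 2 * ‖w - z‖ ^ 2 + (1 + μ * γ) / 2 * ‖w - u‖ ^ 2 ≤ 1 / 2 * ‖z - u‖ ^ 2 := by
  have hp : 0 < 1 + μ * γ := by positivity
  have hc : 0 ≤ γ / (1 + μ * γ) := by positivity
  have h := (strongConvexOn_prox_objective hg hc _).le_of_isMinOn
    (prox_isMinOn hg hc ((1 / (1 + μ * γ)) • (z - γ • s))) u
  rw [← hw] at h
  set q := (1 / (1 + μ * γ)) • (z - γ • s) with hq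
  have hqs : (1 + μ * γ) • q = z - γ • s := by
    rw [hq, smul_smul, mul_one_div_cancel hp.ne', one_smul]
  -- Scaling by `1 + μγ` turns the prox of `g` at the shrunken point into a step of length `γ` for
  -- `g + (μ / 2) ‖·‖²`.
  have h1 := mul_le_mul_of_nonneg_left h hp.le
  have h2 : (1 + μ * γ) * (γ / (1 + μ * γ) * g w + 1 / 2 * ‖w - q‖ ^ 2 + 1 / 2 * ‖u - w‖ ^ 2) =
      γ * g w + (1 + μ * γ) * (1 / 2 * ‖w - q‖ ^ 2 + 1 / 2 * ‖u - w‖ ^ 2) := by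
    field_simp
    ring
  have h3 : (1 + μ * γ) * (γ / (1 + μ * γ) * g u + 1 / 2 * ‖u - q‖ ^ 2) =
      γ * g u + (1 + μ * γ) * (1 / 2 * ‖u - q‖ ^ 2) := by
    field_simp
  rw [h2, h3] at h1
  have h4 : (1 + μ * γ) * inner ℝ q u = inner ℝ z u - γ * inner ℝ s u := by
    rw [← real_inner_smul_left, hqs, inner_sub_left, real_inner_smul_left]
  have h5 : (1 + μ * γ) * inner ℝ q w = inner ℝ z w - γ * inner ℝ s w := by
    rw [← real_inner_smul_left, hqs, inner_sub_left, real_inner_smul_left]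
  rw [real_inner_comm u q, real_inner_comm u z] at h4
  rw [real_inner_comm w q, real_inner_comm w z] at h5
  simp only [norm_sub_sq_real, inner_sub_right] at h1 ⊢
  rw [real_inner_comm u w, real_inner_comm u z]
  linarith

/-! ### Averages against deviations. -/

namespace Agents

variable {m d : ℕ}

theorem avg_add (x y : Agents m d) : avg (x + y) = avg x + avg y := by
  simp [avg, Finset.sum_add_distrib]

theorem avg_sub (x y : Agents m d) : avg (x - y) = avg x - avg y := by
  simp [avg, Finset.sum_sub_distrib, smul_sub]

theorem avg_smul (c : ℝ) (x : Agents m d) : avg (c • x) = c • avg x := by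
  simp [avg, ← Finset.smul_sum, smul_comm c]

theorem avg_const (hm : 0 < m) (v : EuclideanSpace ℝ (Fin d)) : avg (const m v) = v := by
  have : (m : ℝ) ≠ 0 := by positivity
  simp only [avg, const, Finset.sum_const, Finset.card_univ, Fintype.card_fin,
    ← Nat.cast_smul_eq_nsmul ℝ, smul_smul]
  rw [one_div_mul_cancel this, one_smul]

theorem sum_eq_smul_avg (hm : 0 < m) (x : Agents m d) : ∑ i, x i = (m : ℝ) • avg x := by
  have : (m : ℝ) ≠ 0 := by positivity
  rw [avg, smul_smul, mul_one_div_cancel this, one_smul]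

theorem dis_nonneg (x : Agents m d) : 0 ≤ dis x := by
  unfold dis normSq
  positivity

theorem dis_const (hm : 0 < m) (v : EuclideanSpace ℝ (Fin d)) : dis (const m v) = 0 := by
  simp only [dis, normSq, dev, avg_const hm]
  simp [const]

theorem normSq_add_le (x y : Agents m d) : normSq (x + y) ≤ 2 * normSq x + 2 * normSq y := by
  simp only [normSq, Finset.mul_sum, ← Finset.sum_add_distrib]
  refine Finset.sum_le_sum fun i _ => ?_
  have h := norm_add_le (x i) (y i)
  have h2 : ‖(x + y) i‖ ^ 2 ≤ (‖x i‖ + ‖y i‖) ^ 2 := by gcongr; exact h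
  nlinarith [sq_nonneg (‖x i‖ - ‖y i‖)]

theorem dis_add_le (x y : Agents m d) : dis (x + y) ≤ 2 * dis x + 2 * dis y := by
  have : dev (x + y) = dev x + dev y := by
    funext i
    simp only [dev, avg_add, Pi.add_apply]
    abel
  rw [dis, this]
  exact normSq_add_le _ _

theorem dis_smul (c : ℝ) (x : Agents m d) : dis (c • x) = c ^ 2 * dis x := by
  simp only [dis, normSq, dev, avg_smul, Pi.smul_apply, ← smul_sub, norm_smul, mul_pow,
    Real.norm_eq_abs, sq_abs, Finset.mul_sum]

theorem sum_inner_sub (hm : 0 < m) (s w : Agents m d) (u : EuclideanSpace ℝ (Fin d)) :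
    ∑ i, inner ℝ (s i) (w i - u) =
      m * inner ℝ (avg s) (avg w - u) + ∑ i, inner ℝ (dev s i) (dev w i) := by
  have h1 : ∀ i, inner ℝ (s i) (w i - u) =
      inner ℝ (avg s) (dev w i) + inner ℝ (s i) (avg w - u) + inner ℝ (dev s i) (dev w i) := by
    intro i
    simp only [dev, inner_sub_left, inner_sub_right]
    ring
  simp only [h1, Finset.sum_add_distrib, ← inner_sum, ← sum_inner, sum_dev hm, inner_zero_right,
    sum_eq_smul_avg hm s, real_inner_smul_left, zero_add]

theorem sum_norm_sub_sq (hm : 0 < m) (x : Agents m d) (v : EuclideanSpace ℝ (Fin d)) :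
    ∑ i, ‖x i - v‖ ^ 2 = dis x + m * ‖avg x - v‖ ^ 2 := by
  have h1 : ∀ i, ‖x i - v‖ ^ 2 =
      ‖dev x i‖ ^ 2 + 2 * inner ℝ (dev x i) (avg x - v) + ‖avg x - v‖ ^ 2 := by
    intro i
    rw [← norm_add_sq_real, dev]
    congr 2
    abel
  simp only [h1, Finset.sum_add_distrib, ← Finset.mul_sum, ← sum_inner, sum_dev hm,
    inner_zero_left, Finset.sum_const, Finset.card_univ, Fintype.card_fin, nsmul_eq_mul, dis,
    normSq]
  ring

theorem dis_le_normSq (hm : 0 < m) (x : Agents m d) : dis x ≤ normSq x := by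
  have := sum_norm_sub_sq hm x 0
  simp only [sub_zero] at this
  rw [normSq, this]
  have : 0 ≤ (m : ℝ) * ‖avg x‖ ^ 2 := by positivity
  linarith

theorem mul_norm_avg_sub_sq_le (hm : 0 < m) (x y : Agents m d) :
    m * ‖avg x - avg y‖ ^ 2 ≤ ∑ i, ‖x i - y i‖ ^ 2 := by
  have := sum_norm_sub_sq hm (x - y) 0
  simp only [sub_zero, avg_sub, Pi.sub_apply] at this
  rw [this]
  linarith [dis_nonneg (x - y)]

theorem neg_inner_dev_le (s w : Agents m d) {a b : ℝ} (ha : 0 < a) (hab : 1 ≤ 4 * a * b) :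
    -∑ i, inner ℝ (dev s i) (dev w i) ≤ a * dis w + b * dis s := by
  simp only [dis, normSq, Finset.mul_sum, ← Finset.sum_add_distrib, ← Finset.sum_neg_distrib]
  refine Finset.sum_le_sum fun i _ => ?_
  have h1 := (abs_le.mp (abs_real_inner_le_norm (dev s i) (dev w i))).1
  have h2 : 0 ≤ 4 * a * (a * ‖dev w i‖ ^ 2 + b * ‖dev s i‖ ^ 2 - ‖dev s i‖ * ‖dev w i‖) := by
    nlinarith [sq_nonneg (2 * a * ‖dev w i‖ - ‖dev s i‖), sq_nonneg ‖dev s i‖]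
  have h3 := nonneg_of_mul_nonneg_right h2 (by positivity)
  linarith

theorem mul_apply_avg_le (hm : 0 < m) {R : EuclideanSpace ℝ (Fin d) → ℝ}
    (hR : ConvexOn ℝ Set.univ R) (w : Agents m d) : m * R (avg w) ≤ ∑ i, R (w i) := by
  have hm' : (0 : ℝ) < m := by positivity
  have h := hR.map_sum_le (t := Finset.univ) (w := fun _ : Fin m => 1 / (m : ℝ)) (p := w)
    (fun _ _ => by positivity) (by simp [hm'.ne']) (fun _ _ => Set.mem_univ _)
  rw [← Finset.smul_sum, ← Finset.smul_sum, smul_eq_mul, one_div, le_inv_mul_iff₀ hm',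
    ← one_div] at h
  exact h

end Agents

/-- The regularizer `g + (μ / 2) ‖·‖²`. -/
noncomputable def shiftedReg {d : ℕ} (μ : ℝ) (g : EuclideanSpace ℝ (Fin d) → ℝ)
    (u : EuclideanSpace ℝ (Fin d)) : ℝ := g u + μ / 2 * ‖u‖ ^ 2

theorem convexOn_shiftedReg {d : ℕ} {μ : ℝ} (hμ : 0 ≤ μ) {g : EuclideanSpace ℝ (Fin d) → ℝ}
    (hg : ConvexOn ℝ Set.univ g) : ConvexOn ℝ Set.univ (shiftedReg μ g) := by
  refine hg.add (ConvexOn.smul (c := μ / 2) (by positivity) ?_)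
  exact (convexOn_norm convex_univ).pow (fun _ _ => norm_nonneg _) 2

/-! ### The proximal step on all rows. -/

section ProxStep

variable {m d : ℕ} {g : EuclideanSpace ℝ (Fin d) → ℝ} {μ γ : ℝ} {z s w : Agents m d}

theorem sum_prox_three_point (hm : 0 < m) (hg : ConvexOn ℝ Set.univ g) (hμ : 0 ≤ μ) (hγ : 0 ≤ γ)
    (hw : w = fun i => prox (γ / (1 + μ * γ)) g ((1 / (1 + μ * γ)) • (z i - γ • s i)))
    (u : EuclideanSpace ℝ (Fin d)) :
    γ * (∑ i, shiftedReg μ g (w i) - m * shiftedReg μ g u) +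
      γ * (m * inner ℝ (avg s) (avg w - u) + ∑ i, inner ℝ (dev s i) (dev w i)) +
      1 / 2 * (m * ‖avg w - avg z‖ ^ 2) + (1 + μ * γ) / 2 * ∑ i, ‖w i - u‖ ^ 2 ≤
      1 / 2 * ∑ i, ‖z i - u‖ ^ 2 := by
  have h := Finset.sum_le_sum fun i (_ : i ∈ Finset.univ) =>
    prox_three_point hg hμ hγ (z i) (s i) u (congrFun hw i)
  simp only [Finset.sum_add_distrib, Finset.sum_sub_distrib, ← Finset.mul_sum,
    sum_inner_sub hm, Finset.sum_const, Finset.card_univ, Fintype.card_fin, nsmul_eq_mul] at h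
  have h2 := mul_norm_avg_sub_sq_le hm w z
  simp only [shiftedReg, Finset.sum_add_distrib, ← Finset.mul_sum]
  linarith

/-- Take the average of `w` as comparison point: Jensen makes the regularizer gap nonnegative, and
the squared movement of the averages cancels. -/
theorem dis_prox_le (hm : 0 < m) (hg : ConvexOn ℝ Set.univ g) (hμ : 0 ≤ μ) (hγ : 0 ≤ γ)
    (hw : w = fun i => prox (γ / (1 + μ * γ)) g ((1 / (1 + μ * γ)) • (z i - γ • s i))) :
    dis w ≤ 2 * dis z + 4 * (γ ^ 2 * dis s) := by
  have h := sum_prox_three_point hm hg hμ hγ hw (avg w)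
  rw [sum_norm_sub_sq hm, sum_norm_sub_sq hm, sub_self, inner_zero_right, norm_zero,
    norm_sub_rev (avg z)] at h
  have h1 := mul_nonneg hγ
    (sub_nonneg.mpr (mul_apply_avg_le hm (convexOn_shiftedReg hμ hg) w))
  have h2 : 0 ≤ μ * γ * dis w := mul_nonneg (by positivity) (dis_nonneg w)
  have h3 : -(γ * ∑ i, inner ℝ (dev s i) (dev w i)) ≤ 1 / 4 * dis w + γ ^ 2 * dis s := by
    have h4 := neg_inner_dev_le (γ • s) w (a := 1 / 4) (b := 1) (by norm_num) (by norm_num)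
    have h5 : ∀ i, dev (γ • s) i = γ • dev s i := fun i => by
      simp only [dev, avg_smul, Pi.smul_apply, smul_sub]
    simpa only [h5, real_inner_smul_left, ← Finset.mul_sum, dis_smul, one_mul] using h4
  linarith

end ProxStep

/-- The contraction of the scalar errors over one round. -/
theorem error_recursion {τ B Z X Y Q S N B' Z' X' Y' Q' S' N' w Γ : ℝ}
    (hτ : τ ≤ 1 / 20) (hX : 0 ≤ X) (hY : 0 ≤ Y) (hQ : 0 ≤ Q) (hS : 0 ≤ S) (hN : 0 ≤ N)
    (hN' : 0 ≤ N') (hΓ : 0 ≤ Γ)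
    (hmain : B' + (1 + τ) * Z' ≤ (1 - τ) * B + Z + w + S' + 1 / 400 * X' - 399 / 400 * N' -
      (1 - τ) * Γ)
    (hX' : X' ≤ 2 * Q + 2 * Y) (hw : w ≤ 2 * Q + 4 * S')
    (hS' : S' ≤ 3 / 2048 * (2 * S + 1 / 100 * Γ + 1 / 40000 * (X + N)))
    (hQ' : Q' ≤ 3 / 2048 * w) (hY' : Y' ≤ 3 / 2048 * (2 * Q' + 2 * Y)) :
    B' + (1 + τ) * Z' + (X' + 3 * Y' + 6 * Q' + S' + 1 / 4 * N') ≤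
      (1 - τ) * B + Z + 39 / 40 * (X + 3 * Y + 6 * Q + S + 1 / 4 * N) := by
  -- This much of `Γ` covers its share in `S'`, and `399 / 400 * N'` covers the weight of `N'`; the
  -- remaining coefficients fit the weights `1, 3, 6, 1, 1/4`.
  have h : 19 / 20 * Γ ≤ (1 - τ) * Γ := mul_le_mul_of_nonneg_right (by linarith) hΓ
  linarith

/-! ### One round of the algorithm. -/

section Round

variable {m d : ℕ} {φ : Fin m → EuclideanSpace ℝ (Fin d) → ℝ}
  {D : Fin m → EuclideanSpace ℝ (Fin d) → EuclideanSpace ℝ (Fin d)}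
  {g : EuclideanSpace ℝ (Fin d) → ℝ} {h μ γ τ : ℝ}

theorem sum_smooth_descent (hm : 0 < m) (hh : 0 < h) (hτ0 : 0 ≤ τ) (hτ1 : τ ≤ 1)
    (lower : ∀ i x u, φ i x + inner ℝ (D i x) (u - x) ≤ φ i u)
    (upper : ∀ i x u, φ i u ≤ φ i x + inner ℝ (D i x) (u - x) + h / 2 * ‖u - x‖ ^ 2)
    {x' y z : Agents m d} (hx' : x' = τ • z + (1 - τ) • y) (zb u : EuclideanSpace ℝ (Fin d)) :
    ∑ i, φ i (τ • zb + (1 - τ) • avg y) ≤ τ * ∑ i, φ i u + (1 - τ) * ∑ i, φ i (avg y) +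
      τ * (m * inner ℝ (avg fun i => D i (x' i)) (zb - u)) +
      h / 2 * (dis x' + m * (τ ^ 2 * ‖zb - avg z‖ ^ 2)) -
      (1 - τ) * (1 / (2 * h) * ∑ i, ‖D i (x' i) - D i (avg y)‖ ^ 2) := by
  have hs := Finset.sum_le_sum fun i (_ : i ∈ Finset.univ) =>
    smooth_convex_combination_bound hh (lower i) (upper i) hτ0 hτ1 (x' i)
      (τ • zb + (1 - τ) • avg y) u (avg y)
  have h1 : τ • zb + (1 - τ) • avg y - (τ • u + (1 - τ) • avg y) = τ • (zb - u) := by module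
  have h2 : ∑ i, ‖τ • zb + (1 - τ) • avg y - x' i‖ ^ 2 =
      dis x' + m * (τ ^ 2 * ‖zb - avg z‖ ^ 2) := by
    simp only [norm_sub_rev (τ • zb + (1 - τ) • avg y), sum_norm_sub_sq hm]
    rw [hx', avg_add, avg_smul, avg_smul,
      show τ • avg z + (1 - τ) • avg y - (τ • zb + (1 - τ) • avg y) = τ • (avg z - zb) by module,
      norm_smul, mul_pow, Real.norm_eq_abs, sq_abs, norm_sub_rev zb]
  have h3 : ∑ i, inner ℝ (D i (x' i)) (zb - u) =
      m * inner ℝ (avg fun i => D i (x' i)) (zb - u) := by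
    rw [← sum_inner, sum_eq_smul_avg hm (fun i => D i (x' i)), real_inner_smul_left]
  simp only [h1, inner_smul_right, Finset.sum_add_distrib, Finset.sum_sub_distrib,
    ← Finset.mul_sum, h2, h3] at hs
  exact hs

theorem round_descent (hm : 0 < m) (hh : 0 < h) (hμ : 0 < μ) (hγ : 0 < γ) (hτ : τ = μ * γ)
    (hτ1 : τ ≤ 1 / 20) (hγτ : h * γ * τ = 1 / 400) (hg : ConvexOn ℝ Set.univ g)
    (lower : ∀ i x u, φ i x + inner ℝ (D i x) (u - x) ≤ φ i u)
    (upper : ∀ i x u, φ i u ≤ φ i x + inner ℝ (D i x) (u - x) + h / 2 * ‖u - x‖ ^ 2)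
    {x' y z s' w : Agents m d} (hx' : x' = τ • z + (1 - τ) • y)
    (hs' : avg s' = avg fun i => D i (x' i))
    (hw : w = fun i => prox (γ / (1 + μ * γ)) g ((1 / (1 + μ * γ)) • (z i - γ • s' i)))
    {Φ : EuclideanSpace ℝ (Fin d) → ℝ}
    (hΦ : ∀ v, Φ v = ∑ i, φ i v + m * shiftedReg μ g v) (u : EuclideanSpace ℝ (Fin d)) :
    2 / μ * (Φ (τ • avg w + (1 - τ) • avg y) - Φ u) + (1 + τ) * ∑ i, ‖w i - u‖ ^ 2 ≤
      (1 - τ) * (2 / μ * (Φ (avg y) - Φ u)) + ∑ i, ‖z i - u‖ ^ 2 + dis w + γ ^ 2 * dis s' +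
      1 / 400 * (dis x' / τ ^ 2) - 399 / 400 * (m * ‖avg w - avg z‖ ^ 2) -
      (1 - τ) * (1 / (h * μ) * ∑ i, ‖D i (x' i) - D i (avg y)‖ ^ 2) := by
  have hτ0 : 0 < τ := by rw [hτ]; positivity
  have h1 := sum_smooth_descent hm hh hτ0.le (by linarith) lower upper hx' (avg w) u
  have h2 := sum_prox_three_point hm hg hμ.le hγ.le hw u
  have h3 := mul_apply_avg_le hm (convexOn_shiftedReg hμ.le hg) w
  have h4 := (convexOn_shiftedReg hμ.le hg).2 (Set.mem_univ (avg w)) (Set.mem_univ (avg y))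
    hτ0.le (by linarith : 0 ≤ 1 - τ) (by ring)
  have h5 : -(2 * γ * ∑ i, inner ℝ (dev s' i) (dev w i)) ≤ dis w + γ ^ 2 * dis s' := by
    -- These weights saturate `4ab = 1` and, after scaling by `2γ`, give coefficients `1` and `γ ^
    -- 2`.
    have h6 := neg_inner_dev_le s' w (a := 1 / (2 * γ)) (b := γ / 2) (by positivity)
      (le_of_eq (by field_simp; norm_num))
    have h7 := mul_le_mul_of_nonneg_left h6 (by positivity : 0 ≤ 2 * γ)
    have h8 : 2 * γ * (1 / (2 * γ) * dis w + γ / 2 * dis s') = dis w + γ ^ 2 * dis s' := by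
      field_simp
    linarith
  rw [← hs'] at h1
  rw [← hτ] at h2
  simp only [smul_eq_mul] at h4
  have h6 := mul_le_mul_of_nonneg_left h4 (Nat.cast_nonneg (α := ℝ) m)
  have h7 := mul_le_mul_of_nonneg_left h3 hτ0.le
  set P := m * inner ℝ (avg s') (avg w - u) with hP
  set RW := ∑ i, shiftedReg μ g (w i)
  set Γ := ∑ i, ‖D i (x' i) - D i (avg y)‖ ^ 2
  set Δ := ‖avg w - avg z‖ ^ 2
  have h8 : Φ (τ • avg w + (1 - τ) • avg y) - Φ u ≤ (1 - τ) * (Φ (avg y) - Φ u) +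
      τ * (RW - m * shiftedReg μ g u + P) + h / 2 * (dis x' + m * (τ ^ 2 * Δ)) -
      (1 - τ) * (1 / (2 * h) * Γ) := by
    rw [hΦ, hΦ, hΦ]
    linarith
  have h9 := mul_le_mul_of_nonneg_left h8 (by positivity : 0 ≤ 2 / μ)
  have h10 : 2 / μ * ((1 - τ) * (Φ (avg y) - Φ u) +
      τ * (RW - m * shiftedReg μ g u + P) + h / 2 * (dis x' + m * (τ ^ 2 * Δ)) -
      (1 - τ) * (1 / (2 * h) * Γ)) = (1 - τ) * (2 / μ * (Φ (avg y) - Φ u)) +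
      2 * (τ / μ) * (RW - m * shiftedReg μ g u + P) +
      (h * τ ^ 2 / μ) * (dis x' / τ ^ 2 + m * Δ) - (1 - τ) * (1 / (h * μ) * Γ) := by
    field_simp
  have h11 : τ / μ = γ := by rw [hτ]; field_simp
  have h12 : h * τ ^ 2 / μ = 1 / 400 := by
    rw [← hγτ, ← h11]
    ring
  rw [h10, h11, h12] at h9
  linarith

/-- Both gradients are compared with those at a common point `v`. For `v` the average of `y`, the
first sum is the one that the descent estimate subtracts. -/
theorem tracking_increment_le (hm : 0 < m) (hh : 0 < h)
    (lower : ∀ i x u, φ i x + inner ℝ (D i x) (u - x) ≤ φ i u)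
    (upper : ∀ i x u, φ i u ≤ φ i x + inner ℝ (D i x) (u - x) + h / 2 * ‖u - x‖ ^ 2)
    (x x' : Agents m d) (v : EuclideanSpace ℝ (Fin d)) :
    dis ((fun i => D i (x' i)) - fun i => D i (x i)) ≤
      2 * ∑ i, ‖D i (x' i) - D i v‖ ^ 2 + 2 * (h ^ 2 * (dis x + m * ‖avg x - v‖ ^ 2)) := by
  have h1 : ((fun i => D i (x' i)) - fun i => D i (x i)) =
      (fun i => D i (x' i) - D i v : Agents m d) + fun i => D i v - D i (x i) := by
    funext i
    simp
  refine (dis_le_normSq hm _).trans ?_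
  rw [h1]
  refine (normSq_add_le _ _).trans ?_
  rw [← sum_norm_sub_sq hm, Finset.mul_sum (a := h ^ 2), normSq, normSq]
  gcongr with i _
  rw [norm_sub_rev (x i)]
  exact norm_sq_sub_le_of_smooth hh (lower i) (upper i) _ _

/-- The consensus errors, with the weights of the Lyapunov function. -/
noncomputable def consensusError (τ γ : ℝ) (p : OdapgState m d) : ℝ :=
  dis p.x / τ ^ 2 + 3 * (dis p.y / τ ^ 2) + 6 * dis p.z + γ ^ 2 * dis p.s +
    1 / 4 * (m * ‖avg p.x - avg p.y‖ ^ 2 / τ ^ 2)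

theorem consensusError_nonneg (τ γ : ℝ) (p : OdapgState m d) : 0 ≤ consensusError τ γ p := by
  have := dis_nonneg p.x
  have := dis_nonneg p.y
  have := dis_nonneg p.z
  have := dis_nonneg p.s
  unfold consensusError
  positivity

theorem odapgStep_lyapunov {f : Fin m → EuclideanSpace ℝ (Fin d) → ℝ}
    (hm : 0 < m) (hh : 0 < h) (hμ : 0 < μ) (hγ : 0 < γ) (hτ : τ = μ * γ)
    (hτ1 : τ ≤ 1 / 20) (hγτ : h * γ * τ = 1 / 400) (hg : ConvexOn ℝ Set.univ g)
    (hD : D = fun i v => gradient (f i) v - μ • v)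
    (lower : ∀ i x u, φ i x + inner ℝ (D i x) (u - x) ≤ φ i u)
    (upper : ∀ i x u, φ i u ≤ φ i x + inner ℝ (D i x) (u - x) + h / 2 * ‖u - x‖ ^ 2)
    {mix : Agents m d → Agents m d} (havg : ∀ x, avg (mix x) = avg x)
    (hdis : ∀ x, dis (mix x) ≤ 3 / 2048 * dis x)
    {Φ : EuclideanSpace ℝ (Fin d) → ℝ}
    (hΦ : ∀ v, Φ v = ∑ i, φ i v + m * shiftedReg μ g v) (u : EuclideanSpace ℝ (Fin d))
    {p q : OdapgState m d} (hp : avg p.s = avg (gradHat μ f p.x))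
    (hq : q = odapgStep μ γ τ f g mix p) :
    2 / μ * (Φ (avg q.y) - Φ u) + (1 + τ) * ∑ i, ‖q.z i - u‖ ^ 2 + consensusError τ γ q ≤
      (1 - τ) * (2 / μ * (Φ (avg p.y) - Φ u)) + ∑ i, ‖p.z i - u‖ ^ 2 +
        39 / 40 * consensusError τ γ p := by
  have hτ0 : 0 < τ := by rw [hτ]; positivity
  have hqx : q.x = τ • p.z + (1 - τ) • p.y := by rw [hq]; rfl
  have hqs : q.s = mix (p.s + gradHat μ f q.x - gradHat μ f p.x) := by rw [hqx, hq]; rfl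
  set w : Agents m d := fun i =>
    prox (γ / (1 + μ * γ)) g ((1 / (1 + μ * γ)) • (p.z i - γ • q.s i)) with hw
  have hqz : q.z = mix w := by rw [hw, hqs, hqx, hq]; rfl
  have hqy : q.y = mix (τ • q.z + (1 - τ) • p.y) := by rw [hqz, hw, hqs, hqx, hq]; rfl
  have hgrad : ∀ x : Agents m d, gradHat μ f x = fun i => D i (x i) := fun x => by rw [hD]; rfl
  have hsavg : avg q.s = avg fun i => D i (q.x i) := by
    rw [hqs, havg, avg_sub, avg_add, hp, add_sub_cancel_left, hgrad]
  have hzavg : avg q.z = avg w := by rw [hqz, havg]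
  have hyavg : avg q.y = τ • avg w + (1 - τ) • avg p.y := by
    rw [hqy, havg, avg_add, avg_smul, avg_smul, hzavg]
  have hmain := round_descent hm hh hμ hγ hτ hτ1 hγτ hg lower upper hqx hsavg hw hΦ u
  have hwdis := dis_prox_le hm hg hμ.le hγ.le hw
  have hmix2 : ∀ a b : Agents m d, dis (τ • a + (1 - τ) • b) / τ ^ 2 ≤
      2 * dis a + 2 * (dis b / τ ^ 2) := by
    intro a b
    have h1 := dis_add_le (τ • a) ((1 - τ) • b)
    rw [dis_smul, dis_smul] at h1
    have h2 : (1 - τ) ^ 2 * dis b ≤ 1 * dis b :=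
      mul_le_mul_of_nonneg_right (by nlinarith) (dis_nonneg b)
    rw [div_le_iff₀ (by positivity), add_mul, mul_assoc 2 (dis b / τ ^ 2),
      div_mul_cancel₀ _ (by positivity)]
    linarith
  -- Mixing keeps the average and does not increase the deviation.
  have hz' : ∑ i, ‖q.z i - u‖ ^ 2 ≤ ∑ i, ‖w i - u‖ ^ 2 := by
    rw [sum_norm_sub_sq hm, sum_norm_sub_sq hm, hzavg, hqz]
    linarith [hdis w, dis_nonneg w]
  -- Both new averages share the `y` part, so their gap is `τ` times the movement of the averaged
  -- `z`.
  have hN' : m * ‖avg q.x - avg q.y‖ ^ 2 / τ ^ 2 = m * ‖avg w - avg p.z‖ ^ 2 := by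
    rw [hyavg, hqx, avg_add, avg_smul, avg_smul,
      show τ • avg p.z + (1 - τ) • avg p.y - (τ • avg w + (1 - τ) • avg p.y) =
        τ • (avg p.z - avg w) by module, norm_smul, mul_pow, Real.norm_eq_abs, sq_abs,
      norm_sub_rev (avg w)]
    field_simp
  set Γ := ∑ i, ‖D i (q.x i) - D i (avg p.y)‖ ^ 2 with hΓ
  have hΓ0 : 0 ≤ Γ := by positivity
  have hS' : γ ^ 2 * dis q.s ≤ 3 / 2048 * (2 * (γ ^ 2 * dis p.s) + 1 / 100 * (1 / (h * μ) * Γ) +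
      1 / 40000 * (dis p.x / τ ^ 2 + m * ‖avg p.x - avg p.y‖ ^ 2 / τ ^ 2)) := by
    have h1 := tracking_increment_le hm hh lower upper p.x q.x (avg p.y)
    have h2 := hdis (p.s + gradHat μ f q.x - gradHat μ f p.x)
    rw [← hqs, add_sub_assoc] at h2
    have h3 := dis_add_le p.s (gradHat μ f q.x - gradHat μ f p.x)
    rw [hgrad, hgrad] at h2 h3
    have h4 : dis q.s ≤ 3 / 2048 * (2 * dis p.s + 2 * (2 * Γ + 2 * (h ^ 2 *
      (dis p.x + m * ‖avg p.x - avg p.y‖ ^ 2)))) := by linarith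
    have h5 := mul_le_mul_of_nonneg_left h4 (sq_nonneg γ)
    have h6 : γ ^ 2 * (3 / 2048 * (2 * dis p.s + 2 * (2 * Γ + 2 * (h ^ 2 *
        (dis p.x + m * ‖avg p.x - avg p.y‖ ^ 2))))) =
        3 / 2048 * (2 * (γ ^ 2 * dis p.s) + 4 * (h * γ * (μ * γ)) * (1 / (h * μ) * Γ) +
        4 * (h * γ * τ) ^ 2 *
          (dis p.x / τ ^ 2 + m * ‖avg p.x - avg p.y‖ ^ 2 / τ ^ 2)) := by
      field_simp
      ring
    rw [h6, ← hτ, hγτ] at h5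
    linarith
  have hX0 : 0 ≤ dis p.x / τ ^ 2 := div_nonneg (dis_nonneg _) (sq_nonneg _)
  have hY0 : 0 ≤ dis p.y / τ ^ 2 := div_nonneg (dis_nonneg _) (sq_nonneg _)
  have hY' : dis q.y / τ ^ 2 ≤ 3 / 2048 * (2 * dis q.z + 2 * (dis p.y / τ ^ 2)) := by
    have h1 := hdis (τ • q.z + (1 - τ) • p.y)
    rw [← hqy] at h1
    have h2 := div_le_div_of_nonneg_right h1 (sq_nonneg τ)
    rw [mul_div_assoc] at h2
    linarith [hmix2 q.z p.y]
  have hX' : dis q.x / τ ^ 2 ≤ 2 * dis p.z + 2 * (dis p.y / τ ^ 2) := by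
    rw [hqx]
    exact hmix2 _ _
  rw [← hyavg] at hmain
  have hz'' := mul_le_mul_of_nonneg_left hz' (by linarith : 0 ≤ 1 + τ)
  have hfin := error_recursion (N := m * ‖avg p.x - avg p.y‖ ^ 2 / τ ^ 2) hτ1 hX0 hY0
    (dis_nonneg p.z)
    (mul_nonneg (sq_nonneg γ) (dis_nonneg p.s)) (by positivity) (by positivity)
    (mul_nonneg (by positivity) hΓ0) hmain hX' hwdis hS'
    (by rw [hqz]; exact hdis w) hY'
  rw [consensusError, consensusError, hN']
  linarith

end Round

/-! ### Iteration and conclusion. -/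

theorem avg_odapg_s {m d : ℕ} {μ γ τ : ℝ} {f : Fin m → EuclideanSpace ℝ (Fin d) → ℝ}
    {g : EuclideanSpace ℝ (Fin d) → ℝ} {mix : Agents m d → Agents m d}
    (havg : ∀ x, avg (mix x) = avg x) (x₁ : EuclideanSpace ℝ (Fin d)) (n : ℕ) :
    avg (odapg μ γ τ f g mix x₁ n).s = avg (gradHat μ f (odapg μ γ τ f g mix x₁ n).x) := by
  induction n with
  | zero => rfl
  | succ n ih =>
    simp only [odapg, odapgStep]
    rw [havg, avg_sub, avg_add, ih, add_sub_cancel_left]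

/-- For `τ ≤ 1 / 20`, each of `1 - τ`, `1 / (1 + τ)` and `39 / 40` is at most `1 - τ / 2`. After `n`
rounds the exponent is nevertheless `n + 1`, thanks to `hinit`. -/
theorem lyapunov_iterate {B Z E : ℕ → ℝ} {τ : ℝ} (hτ0 : 0 ≤ τ) (hτ1 : τ ≤ 1 / 20)
    (hB : ∀ n, 0 ≤ B n) (hZ : ∀ n, 0 ≤ Z n) (hE : ∀ n, 0 ≤ E n) (hinit : Z 0 ≤ B 0)
    (hstep : ∀ n, B (n + 1) + (1 + τ) * Z (n + 1) + E (n + 1) ≤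
      (1 - τ) * B n + Z n + 39 / 40 * E n) (n : ℕ) :
    Z n ≤ (1 - τ / 2) ^ (n + 1) * (B 0 + Z 0 + 15 / 7 * E 0) := by
  have hc : 0 ≤ 1 - τ / 2 := by linarith
  have hvals : 0 ≤ τ * Z 0 ∧ 0 ≤ τ * E 0 ∧ 0 ≤ τ * (B 0 - Z 0) :=
    ⟨mul_nonneg hτ0 (hZ 0), mul_nonneg hτ0 (hE 0), mul_nonneg hτ0 (by linarith)⟩
  obtain ⟨h1, h2, h3⟩ := hvals
  -- Since `Z 0 ≤ B 0`, losing `τ * B 0` already gives `(1 - τ / 2) * (B 0 + Z 0)`, while the target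
  -- factor is at least `1 - τ / 20`.
  have hfirst : B 1 + (1 + τ) * Z 1 + E 1 ≤
      (1 + τ) * (1 - τ / 2) ^ 2 * (B 0 + Z 0 + 15 / 7 * E 0) := by
    have hs := hstep 0
    rw [zero_add] at hs
    have hk : (1 + τ) * (1 - τ / 2) ^ 2 = 1 - τ * (3 / 4 * τ - τ ^ 2 / 4) := by ring
    have hk1 : 1 - τ / 20 ≤ (1 + τ) * (1 - τ / 2) ^ 2 := by
      rw [hk]
      nlinarith [mul_nonneg hτ0 (sub_nonneg.mpr hτ1), pow_nonneg hτ0 3]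
    have hsum : 0 ≤ B 0 + Z 0 + 15 / 7 * E 0 := by linarith [hB 0, hZ 0, hE 0]
    have hle := mul_le_mul_of_nonneg_right hk1 hsum
    have h4 : τ * E 0 ≤ 1 / 20 * E 0 := mul_le_mul_of_nonneg_right hτ1 (hE 0)
    have := hE 0
    linarith
  have hiter : ∀ k, B (k + 1) + (1 + τ) * Z (k + 1) + E (k + 1) ≤
      (1 + τ) * (1 - τ / 2) ^ (k + 2) * (B 0 + Z 0 + 15 / 7 * E 0) := by
    intro k
    induction k with
    | zero => exact hfirst
    | succ k ih =>
      have hs := hstep (k + 1)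
      have h4 := mul_le_mul_of_nonneg_left ih hc
      have h5 : 0 ≤ τ * B (k + 1) := mul_nonneg hτ0 (hB _)
      have h6 : 0 ≤ τ * (1 - τ) * Z (k + 1) :=
        mul_nonneg (mul_nonneg hτ0 (by linarith)) (hZ _)
      have h7 : 0 ≤ (1 / 20 - τ) * E (k + 1) := mul_nonneg (by linarith) (hE _)
      calc _ ≤ (1 - τ / 2) * (B (k + 1) + (1 + τ) * Z (k + 1) + E (k + 1)) := by linarith
        _ ≤ _ := h4
        _ = _ := by ring
  rcases n with _ | k
  · have h4 : 0 ≤ (1 - τ / 2) * E 0 := mul_nonneg hc (hE 0)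
    have h5 : 0 ≤ (1 - τ / 2) * (B 0 - Z 0) := mul_nonneg hc (by linarith)
    have h6 : 0 ≤ (1 - τ) * Z 0 := mul_nonneg (by linarith) (hZ 0)
    rw [zero_add, pow_one]
    linarith
  · have h4 : (1 + τ) * Z (k + 1) ≤
        (1 + τ) * ((1 - τ / 2) ^ (k + 2) * (B 0 + Z 0 + 15 / 7 * E 0)) := by
      linarith [hiter k, hB (k + 1), hE (k + 1)]
    exact le_of_mul_le_mul_left h4 (by linarith)

theorem strongConvexOn_compositeObj {m d : ℕ} (hm : 0 < m)
    {f : Fin m → EuclideanSpace ℝ (Fin d) → ℝ} {g : EuclideanSpace ℝ (Fin d) → ℝ} {μ : ℝ}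
    (hf : ∀ i, StrongConvexOn Set.univ μ (f i)) (hg : ConvexOn ℝ Set.univ g) :
    StrongConvexOn Set.univ μ (compositeObj f g) := by
  have hm' : (0 : ℝ) < m := by positivity
  refine ⟨convex_univ, fun x hx y hy a b ha hb hab => ?_⟩
  have h1 := Finset.sum_le_sum fun i (_ : i ∈ Finset.univ) => (hf i).2 hx hy ha hb hab
  have h2 := hg.2 hx hy ha hb hab
  simp only [smul_eq_mul, Finset.sum_sub_distrib, Finset.sum_add_distrib, ← Finset.mul_sum,
    Finset.sum_const, Finset.card_univ, Fintype.card_fin, nsmul_eq_mul] at h1 h2 ⊢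
  have h3 := mul_le_mul_of_nonneg_left h1 (by positivity : 0 ≤ 1 / (m : ℝ))
  have h4 : 1 / (m : ℝ) * (a * ∑ i, f i x + b * ∑ i, f i y -
      m * (a * b * (μ / 2 * ‖x - y‖ ^ 2))) = a * (1 / (m : ℝ) * ∑ i, f i x) +
      b * (1 / (m : ℝ) * ∑ i, f i y) - a * b * (μ / 2 * ‖x - y‖ ^ 2) := by
    field_simp
  unfold compositeObj
  linarith

theorem step_parameters {L μ γ τ : ℝ} (hμ : 0 < μ) (hL : 2 * μ ≤ L)
    (hγ : γ = 1 / (20 * √((L - μ) * μ))) (hτ : τ = μ * γ) :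
    0 < γ ∧ τ ≤ 1 / 20 ∧ (L - μ) * γ * τ = 1 / 400 ∧ τ / 2 = 1 / 40 * √(μ / (L - μ)) := by
  have hh : 0 < L - μ := by linarith
  have hroot : 0 < √((L - μ) * μ) := Real.sqrt_pos.mpr (by positivity)
  have hsq : √((L - μ) * μ) ^ 2 = (L - μ) * μ := Real.sq_sqrt (by positivity)
  have hγ0 : 0 < γ := by rw [hγ]; positivity
  have hprod : (L - μ) * γ * τ = 1 / 400 := by
    have : (L - μ) * γ * τ = ((L - μ) * μ) * γ ^ 2 := by rw [hτ]; ring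
    rw [this, hγ, div_pow, mul_pow, hsq]
    field_simp
    norm_num
  have hτe : τ / 2 = 1 / 40 * √(μ / (L - μ)) := by
    have : μ / (L - μ) = (μ / √((L - μ) * μ)) ^ 2 := by
      rw [div_pow, hsq]
      field_simp
    rw [this, Real.sqrt_sq (by positivity), hτ, hγ]
    field_simp
    norm_num
  refine ⟨hγ0, ?_, hprod, hτe⟩
  have : √(μ / (L - μ)) ≤ 1 := Real.sqrt_le_one.mpr ((div_le_one hh).mpr (by linarith))
  linarith

theorem theorem3 {m d : ℕ} (hm : 2 ≤ m)
    (f : Fin m → EuclideanSpace ℝ (Fin d) → ℝ) (g : EuclideanSpace ℝ (Fin d) → ℝ)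
    (L μ : ℝ) (hμ : 0 < μ) (hL : 2 * μ ≤ L)
    (hf_smooth : ∀ i, IsLSmooth L (f i))
    (hf_strong : ∀ i, StrongConvexOn Set.univ μ (f i))
    (hg : ConvexOn ℝ Set.univ g)
    (G : SimpleGraph (Fin m)) (W : Matrix (Fin m) (Fin m) ℝ) (hW : IsWeightMatrix G W)
    (xstar : EuclideanSpace ℝ (Fin d)) (hstar : IsMinOn (compositeObj f g) Set.univ xstar)
    (x₁ : EuclideanSpace ℝ (Fin d))
    (γ τ lam : ℝ) (hγ : γ = 1 / (20 * √((L - μ) * μ))) (hτ : τ = μ * γ)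
    (hlam : lam = lambda2 hW.posSemidef.isHermitian hm)
    (K : ℕ) (hK : 11 / √(1 - lam) ≤ (K : ℝ))
    (state : ℕ → OdapgState m d)
    (hstate : state = odapg μ γ τ f g (fastMix W (mixEta lam) K) x₁)
    (T : ℕ) (hT : 1 ≤ T) :
    Agents.normSq ((state (T - 1)).z - Agents.const m xstar) ≤
      (1 - 1 / 40 * √(μ / (L - μ))) ^ T *
        (2 * (m : ℝ) / μ *
            (compositeObj f g (Agents.avg (state 0).y) - compositeObj f g xstar)
          + Agents.normSq ((state 0).z - Agents.const m xstar)
          + 6 * 20 ^ 2 * (L - μ) / μ *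
            (Agents.normSq (Agents.leftMul (consensusProj m) (state 0).x)
              + 64 * Agents.normSq (Agents.leftMul (consensusProj m) (state 0).y)
              + 9 * τ ^ 2 / 32 *
                Agents.normSq (Agents.leftMul (consensusProj m) (state 0).z)
              + 5 * τ ^ 2 / 14 * γ ^ 2 *
                Agents.normSq (Agents.leftMul (consensusProj m) (state 0).s))) := by
  have hm0 : 0 < m := by omega
  have hm' : (0 : ℝ) < m := by positivity
  have hh : 0 < L - μ := by linarith
  obtain ⟨hγ0, hτ1, hγτ, hrate⟩ := step_parameters hμ hL hγ hτ
  have hτ0 : 0 < τ := by rw [hτ]; positivity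
  set φ : Fin m → EuclideanSpace ℝ (Fin d) → ℝ := fun i v => f i v - μ / 2 * ‖v‖ ^ 2 with hφ
  set D : Fin m → EuclideanSpace ℝ (Fin d) → EuclideanSpace ℝ (Fin d) :=
    fun i v => gradient (f i) v - μ • v with hD
  have hexpand : ∀ x u : EuclideanSpace ℝ (Fin d),
      inner ℝ x (u - x) = 1 / 2 * ‖u‖ ^ 2 - 1 / 2 * ‖x‖ ^ 2 - 1 / 2 * ‖u - x‖ ^ 2 := by
    intro x u
    rw [norm_sub_sq_real, inner_sub_right, real_inner_self_eq_norm_sq, real_inner_comm x u]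
    ring
  have lower : ∀ i x u, φ i x + inner ℝ (D i x) (u - x) ≤ φ i u := by
    intro i x u
    have h1 := (hf_strong i).add_inner_gradient_le ((hf_smooth i).1 x) u
    simp only [hφ, hD, inner_sub_left, real_inner_smul_left, hexpand x u]
    linarith
  have upper : ∀ i x u, φ i u ≤ φ i x + inner ℝ (D i x) (u - x) + (L - μ) / 2 * ‖u - x‖ ^ 2 := by
    intro i x u
    have h1 := (hf_smooth i).2 x u
    rw [norm_sub_rev x u] at h1
    simp only [hφ, hD, inner_sub_left, real_inner_smul_left, hexpand x u]
    linarith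
  have hΦ : ∀ v, m * compositeObj f g v = ∑ i, φ i v + m * shiftedReg μ g v := by
    intro v
    simp only [compositeObj, shiftedReg, hφ, Finset.sum_sub_distrib, Finset.sum_const,
      Finset.card_univ, Fintype.card_fin, nsmul_eq_mul]
    field_simp
    ring
  have havg := avg_fastMix (d := d) hW.isHermitian hW.mulVec_one (mixEta lam) (K := K)
  -- Quadratic growth at the minimizer: makes `B` nonnegative and gives `Z ≤ B` at the common
  -- starting point.
  have hgrowth : ∀ v, μ / 2 * ‖v - xstar‖ ^ 2 ≤ compositeObj f g v - compositeObj f g xstar :=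
    fun v => by
      have := (strongConvexOn_compositeObj hm0 hf_strong hg).le_of_isMinOn hstar v
      linarith
  have hgrowth' : ∀ v, m * ‖v - xstar‖ ^ 2 ≤
      2 / μ * (m * compositeObj f g v - m * compositeObj f g xstar) := by
    intro v
    have h1 := mul_le_mul_of_nonneg_left (hgrowth v) (by positivity : 0 ≤ 2 / μ * m)
    have h2 : 2 / μ * m * (μ / 2 * ‖v - xstar‖ ^ 2) = m * ‖v - xstar‖ ^ 2 := by
      field_simp
    linarith
  have hx0 : (state 0).x = const m x₁ := by rw [hstate]; rfl
  have hy0 : (state 0).y = const m x₁ := by rw [hstate]; rfl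
  have hz0 : (state 0).z = const m x₁ := by rw [hstate]; rfl
  have hiter := lyapunov_iterate
    (B := fun n => 2 / μ *
      (m * compositeObj f g (avg (state n).y) - m * compositeObj f g xstar))
    (Z := fun n => ∑ i, ‖(state n).z i - xstar‖ ^ 2)
    (E := fun n => consensusError τ γ (state n)) hτ0.le hτ1
    (fun n => le_trans (by positivity) (hgrowth' _)) (fun n => by positivity)
    (fun n => consensusError_nonneg _ _ _)
    (by
      simp only [sum_norm_sub_sq hm0, hy0, hz0, dis_const hm0, zero_add, avg_const hm0]
      exact hgrowth' x₁)
    (fun n => odapgStep_lyapunov hm0 hh hμ hγ0 hτ hτ1 hγτ hg hD lower upper havg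
      (hW.dis_fastMix_le hm hlam hK) hΦ xstar
      (by rw [hstate]; exact avg_odapg_s havg x₁ n) (by rw [hstate]; rfl))
    (T - 1)
  rw [Nat.sub_add_cancel hT, hrate] at hiter
  simp only [leftMul_consensusProj]
  refine hiter.trans (le_of_eq ?_)
  have hE0 : consensusError τ γ (state 0) = γ ^ 2 * dis (state 0).s := by
    simp only [consensusError, hx0, hy0, hz0, dis_const hm0, sub_self, norm_zero]
    ring
  have hd0 : normSq (dev (const m x₁)) = 0 := dis_const hm0 x₁
  -- Only the `s` term survives the consensual start, and `6 * 400 * (5 / 14) * (1 / 400) = 15 / 7`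
  -- matches the weight in `lyapunov_iterate`.
  have hcoef : (L - μ) / μ * τ ^ 2 = 1 / 400 := by
    rw [← hγτ, hτ]
    field_simp
  rw [hE0, hx0, hy0, hz0, hd0]
  change _ = _ * (_ + ∑ i, ‖const m x₁ i - xstar‖ ^ 2 +
    6 * 20 ^ 2 * (L - μ) / μ * (0 + 64 * 0 + 9 * τ ^ 2 / 32 * 0 +
      5 * τ ^ 2 / 14 * γ ^ 2 * dis (state 0).s))
  have hs : 6 * 20 ^ 2 * (L - μ) / μ * (0 + 64 * 0 + 9 * τ ^ 2 / 32 * 0 +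
      5 * τ ^ 2 / 14 * γ ^ 2 * dis (state 0).s) =
      6 * 20 ^ 2 * 5 / 14 * ((L - μ) / μ * τ ^ 2) * (γ ^ 2 * dis (state 0).s) := by ring
  rw [hs, hcoef]
  ring
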